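/- Let $K$ be an algebraically closed field of characteristic $0$, let $V$ be a $K$-vector space of dimension $n+1$, and let $k$ be an integer with $3\le k\le\lfloor (n+1)/2\rfloor$. Let $\nu_k(G_{k,n+1})\subset\mathbb P(\bigwedge^k V)=\mathbb P^{N_k}$, $N_k=\binom{n+1}{k}-1$, be the Grassmannian of $k$-dimensional subspaces of $V$ in its Plücker embedding, where the subspace with basis $v_1,\dots,v_k$ is sent to $[v_1\wedge\dots\wedge v_k]$. For $X\subset\mathbb P^N$, let $X^s$ denote the Zariski closure of the union of all linear spaces spanned by $s$ points of $X$; the expected dimension of $X^s$ is $\min\{N,\ s\dim X+s-1\}$. Then the chordal (secant-line) variety $[\nu_k(G_{k,n+1})]^2$ has the expected dimension, that is, $$\dim\,[\nu_k(G_{k,n+1})]^2=\min\{N_k,\ 2\dim\nu_k(G_{k,n+1})+1\}=\min\Big\{\binom{n+1}{k}-1,\ 2k(n+1-k)+1\Big\}.$$ -/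

import Mathlib

open Module
open scoped LinearAlgebra.Projectivization Topology

namespace SecantGrassmann

section ProjectiveGeometry

variable (K : Type*) [Field K] {E : Type*} [AddCommGroup E] [Module K E]

/-- A polynomial function on the vector space `E`, presented without coordinates as a polynomial
in the linear forms on `E`, evaluated at the vector `x`. -/
noncomputable def evalAt (x : E) (p : MvPolynomial (Dual K E) K) : K :=
  MvPolynomial.eval (fun l : Dual K E => l x) p

/-- Values of a homogeneous polynomial scale by the power of the scalar. -/
theorem evalAt_smul {p : MvPolynomial (Dual K E) K} {d : ℕ} (hp : p.IsHomogeneous d)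
    (c : K) (x : E) : evalAt K (c • x) p = c ^ d * evalAt K x p := by
  have h : (fun l : Dual K E => l (c • x)) = fun l => c * l x := by
    funext l; simp
  rw [evalAt, evalAt, h, MvPolynomial.eval_eq, MvPolynomial.eval_eq, Finset.mul_sum]
  refine Finset.sum_congr rfl fun m hm => ?_
  have hd : ∑ i ∈ m.support, m i = d := by
    have := hp (MvPolynomial.mem_support_iff.mp hm)
    rw [← this, Finsupp.weight_apply, Finsupp.sum]
    simp
  simp only [mul_pow]
  rw [Finset.prod_mul_distrib, Finset.prod_pow_eq_pow_sum, hd]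
  ring

/-- The locus in `ℙ(E)` where all polynomials of `S` vanish (used for homogeneous polynomials
only, whose vanishing does not depend on the representative vector). -/
def projZeroLocus (S : Set (MvPolynomial (Dual K E) K)) : Set (ℙ K E) :=
  {x | ∀ p ∈ S, evalAt K x.rep p = 0}

theorem mk_mem_projZeroLocus {S : Set (MvPolynomial (Dual K E) K)}
    (hS : ∀ p ∈ S, ∃ d, p.IsHomogeneous d) (x : E) (hx : x ≠ 0) :
    Projectivization.mk K x hx ∈ projZeroLocus K S ↔ ∀ p ∈ S, evalAt K x p = 0 := by
  obtain ⟨a, ha⟩ := Projectivization.exists_smul_eq_mk_rep K x hx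
  refine forall₂_congr fun p hp => ?_
  obtain ⟨d, hd⟩ := hS p hp
  rw [← ha, Units.smul_def, evalAt_smul K hd]
  simp

/-- A subset of `ℙ(E)` is algebraic if it is the common zero locus of a set of homogeneous
polynomials. -/
def IsAlgebraicSet (Z : Set (ℙ K E)) : Prop :=
  ∃ S : Set (MvPolynomial (Dual K E) K),
    (∀ p ∈ S, ∃ d, p.IsHomogeneous d) ∧ Z = projZeroLocus K S

variable (E) in
/-- The Zariski topology on `ℙ(E)`: the closed sets are the algebraic sets. -/
@[reducible] def zariskiTopology : TopologicalSpace (ℙ K E) :=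
  TopologicalSpace.ofClosed {Z | IsAlgebraicSet K Z}
    (by
      refine ⟨{1}, ?_, ?_⟩
      · rintro p rfl
        exact ⟨0, MvPolynomial.isHomogeneous_one _ _⟩
      · ext x
        simp [projZeroLocus, evalAt])
    (by
      intro A hA
      refine ⟨{p | ∃ Z ∈ A, (∃ d, p.IsHomogeneous d) ∧ ∀ x ∈ Z, evalAt K x.rep p = 0},
        fun p hp => hp.choose_spec.2.1, ?_⟩
      ext x
      constructor
      · rintro hx p ⟨Z, hZ, -, hp⟩
        exact hp x (hx Z hZ)
      · intro hx Z hZ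
        obtain ⟨S, hS, rfl⟩ := hA hZ
        exact fun p hp => hx p ⟨_, hZ, hS p hp, fun y hy => hy p hp⟩)
    (by
      rintro _ ⟨S, hS, rfl⟩ _ ⟨T, hT, rfl⟩
      refine ⟨{p | ∃ s ∈ S, ∃ t ∈ T, p = s * t}, ?_, ?_⟩
      · rintro _ ⟨s, hs, t, ht, rfl⟩
        obtain ⟨a, ha⟩ := hS s hs
        obtain ⟨b, hb⟩ := hT t ht
        exact ⟨a + b, ha.mul hb⟩
      · ext x
        constructor
        · rintro (hx | hx) _ ⟨s, hs, t, ht, rfl⟩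
          · have := hx s hs
            simp only [evalAt] at this
            simp [evalAt, this]
          · have := hx t ht
            simp only [evalAt] at this
            simp [evalAt, this]
        · intro hx
          by_contra hcon
          simp only [Set.mem_union, not_or, projZeroLocus, Set.mem_ofPred_eq, not_forall] at hcon
          obtain ⟨⟨s, hs, hs'⟩, t, ht, ht'⟩ := hcon
          have := hx _ ⟨s, hs, t, ht, rfl⟩
          simp only [evalAt, map_mul, mul_eq_zero] at this hs' ht'
          tauto)

theorem isClosed_zariski_iff (Z : Set (ℙ K E)) :
    IsClosed[zariskiTopology K E] Z ↔ IsAlgebraicSet K Z := by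
  rw [← @isOpen_compl_iff _ _ (zariskiTopology K E)]
  change IsAlgebraicSet K Zᶜᶜ ↔ _
  rw [compl_compl]

/-- The dimension of a subset of `ℙ(E)`: the supremum of the lengths of chains of irreducible
closed subsets, for the topology induced by the Zariski topology. -/
noncomputable def zariskiDim (X : Set (ℙ K E)) : WithBot ℕ∞ :=
  @topologicalKrullDim X ((zariskiTopology K E).induced Subtype.val)

/-- The `s`-th secant variety of `X ⊆ ℙ(E)`: the Zariski closure of the union of the linear
spaces spanned by `s` points of `X`. For `s = 2` this is the chordal variety. -/
def secantVariety (X : Set (ℙ K E)) (s : ℕ) : Set (ℙ K E) :=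
  closure[zariskiTopology K E]
    (⋃ P : Fin s → X, (Projectivization.Subspace.span (Set.range fun i => (P i : ℙ K E)) :
      Set (ℙ K E)))

/-- `X` has the expected `s`-th secant variety: if `dim X = d` and `ℙ(E)` has dimension `N`, then
`dim X^s = min {N, s d + (s - 1)}`. Meant for `s ≥ 1` and `E` of finite positive dimension. -/
def HasExpectedSecantDim (X : Set (ℙ K E)) (s : ℕ) : Prop :=
  ∃ d : ℕ, zariskiDim K X = d ∧
    zariskiDim K (secantVariety K X s) =
      ((min (finrank K E - 1) (s * d + (s - 1)) : ℕ) : WithBot ℕ∞)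

end ProjectiveGeometry

section Pluecker

variable (K : Type*) [Field K] (V : Type*) [AddCommGroup V] [Module K V]

/-- The Grassmannian `G_{k,n+1}` of `k`-dimensional subspaces of `V` (`dim V = n + 1`). -/
abbrev Grassmannian (k : ℕ) : Type _ := {W : Submodule K V // finrank K W = k}

variable {K V}

/-- The wedge of linearly independent vectors is not zero. -/
theorem wedge_ne_zero {k : ℕ} {v : Fin k → V} (hv : LinearIndependent K v) :
    exteriorPower.ιMulti K k v ≠ 0 := by
  have h := exteriorPower.ιMulti_family_linearIndependent_field (n := k) hv
  let s : Set.powersetCard (Fin k) k := ⟨Finset.univ, by simp⟩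
  have hs := h.ne_zero s
  intro h0
  apply hs
  rw [exteriorPower.ιMulti_family]
  have hid : ⇑(Set.powersetCard.ofFinEmbEquiv.symm s) = id := by
    set f : Fin k ↪o Fin k := Set.powersetCard.ofFinEmbEquiv.symm s
    refine (StrictMono.range_inj f.strictMono strictMono_id).mp ?_
    rw [Set.range_id, (Finite.injective_iff_surjective.mp f.injective).range_eq]
  rw [hid]
  exact h0

/-- The Plücker embedding `ν_k`, sending a `k`-dimensional subspace with basis `v_1, …, v_k` to the
point `[v_1 ∧ ⋯ ∧ v_k]` of `ℙ(⋀^k V)`. -/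
noncomputable def plucker [Module.Finite K V] {k : ℕ} (W : Grassmannian K V k) :
    ℙ K (⋀[K]^k V) :=
  Projectivization.mk K
    (exteriorPower.ιMulti K k fun i => (finBasisOfFinrankEq K W.1 W.2 i : V))
    (wedge_ne_zero <| (finBasisOfFinrankEq K W.1 W.2).linearIndependent.map' W.1.subtype
      W.1.ker_subtype)

/-- The Plücker embedding does not depend on the choice of a basis of the subspace. -/
theorem plucker_eq_mk [Module.Finite K V] {k : ℕ} (W : Grassmannian K V k) (v : Fin k → V)
    (hv : LinearIndependent K v) (hvW : ∀ i, v i ∈ W.1) :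
    plucker W = Projectivization.mk K (exteriorPower.ιMulti K k v) (wedge_ne_zero hv) := by
  let e := finBasisOfFinrankEq K W.1 W.2
  let f : W.1 [⋀^Fin k]→ₗ[K] ⋀[K]^k V := (exteriorPower.ιMulti K k).compLinearMap W.1.subtype
  let g : W.1 [⋀^Fin k]→ₗ[K] ⋀[K]^k V :=
    (LinearMap.toSpanSingleton K _ (f e)).compAlternatingMap e.det
  have hfg : f = g := by
    refine Basis.ext_alternating e fun i h => ?_
    let σ : Equiv.Perm (Fin k) := Equiv.ofBijective i (Finite.injective_iff_bijective.1 h)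
    change f (e ∘ σ) = e.det (e ∘ σ) • f e
    rw [AlternatingMap.map_perm, AlternatingMap.map_perm, Basis.det_self]
    simp
  have h : exteriorPower.ιMulti K k v =
      e.det (fun i => (⟨v i, hvW i⟩ : W.1)) • exteriorPower.ιMulti K k fun i => (e i : V) :=
    DFunLike.congr_fun hfg (fun i => (⟨v i, hvW i⟩ : W.1))
  rw [eq_comm]
  exact (Projectivization.mk_eq_mk_iff' K _ _ _ _).mpr ⟨_, h.symm⟩

variable (K V)

/-- The Grassmann variety `ν_k(G_{k,n+1}) ⊆ ℙ(⋀^k V)` in its Plücker embedding. -/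
def grassmannVariety [Module.Finite K V] (k : ℕ) : Set (ℙ K (⋀[K]^k V)) :=
  Set.range (plucker : Grassmannian K V k → ℙ K (⋀[K]^k V))

end Pluecker

end SecantGrassmann

/-! The argument is Terracini's, made explicit. Near a coordinate subspace the cone over the
Grassmannian is parametrized by matrices, and its tangent space there is spanned by the wedges of
basis vectors whose index set differs from that of the subspace in at most one element. For two
complementary coordinate blocks of size `k ≥ 3`, such a set meets one block in at least `k - 1 ≥ 2`
elements and the other in at most one, so no wedge is tangent at both points. Thus the `2d + 2`
tangent vectors, with `d = k(n+1-k)`, are independent (`linearIndependent_tangents`). This also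
gives `2d + 2 ≤ dim ⋀^k V`, which decides the minimum.

Two bounds turn this into Krull dimension. From above (`zariskiDim_le_card`), a chain of irreducible
closed sets gives a chain of primes in the coordinate ring of the cone over a parametrized set,
which embeds in a polynomial ring. From below (`card_le_zariskiDim`), a parametrization of full rank
at the origin is restricted to a coordinate flag; the closures of the images increase strictly, by
the Jacobian criterion and a transcendence degree count. The charts cover only generic points, but a
homogeneous polynomial vanishing on them vanishes on all wedges and chords by perturbation
(`evalAt_chord_eq_zero`). -/

namespace SecantGrassmann

/-! ### Jacobian criterion and Krull dimension of subalgebras of polynomial rings -/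

section CommutativeAlgebra

variable {K : Type*} [Field K]

/-- Chain rule for partial derivatives of polynomials. -/
theorem pderiv_aeval {ι κ : Type*} [Fintype ι] (f : ι → MvPolynomial κ K) (j : κ)
    (F : MvPolynomial ι K) :
    MvPolynomial.pderiv j (MvPolynomial.aeval f F) =
      ∑ i, MvPolynomial.aeval f (MvPolynomial.pderiv i F) * MvPolynomial.pderiv j (f i) := by
  classical
  induction F using MvPolynomial.induction_on with
  | C a => simp
  | add p q hp hq => simp only [map_add, hp, hq, add_mul, Finset.sum_add_distrib]
  | mul_X p i hp =>
    simp only [map_mul, MvPolynomial.aeval_X, MvPolynomial.pderiv_mul, hp, map_add, add_mul,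
      Finset.sum_add_distrib, MvPolynomial.pderiv_X, Finset.sum_mul]
    congr 1
    · exact Finset.sum_congr rfl fun _ _ => by ring
    · rw [Finset.sum_eq_single i]
      · simp
      · intro l _ hl
        simp [hl.symm]
      · simp

/-- Characteristic zero enters here: differentiation multiplies a coefficient by a positive
exponent, which is nonzero in `K`. -/
theorem eq_C_of_pderiv_eq_zero [CharZero K] {ι : Type*} {F : MvPolynomial ι K}
    (h : ∀ i, MvPolynomial.pderiv i F = 0) : F = MvPolynomial.C (MvPolynomial.coeff 0 F) := by
  classical
  ext m
  rw [MvPolynomial.coeff_C]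
  split_ifs with hm
  · rw [← hm]
  · obtain ⟨i, hi⟩ : ∃ i, m i ≠ 0 := by
      by_contra! hcon
      exact hm (Finsupp.ext fun i => (hcon i).symm)
    have h1 := congrArg (MvPolynomial.coeff (m - Finsupp.single i 1)) (h i)
    have h2 : m - Finsupp.single i 1 + Finsupp.single i 1 = m :=
      tsub_add_cancel_of_le (Finsupp.single_le_iff.mpr (Nat.one_le_iff_ne_zero.mpr hi))
    rw [MvPolynomial.coeff_pderiv, h2, MvPolynomial.coeff_zero] at h1
    refine (mul_eq_zero.mp h1).resolve_right ?_
    exact Nat.cast_add_one_ne_zero _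

theorem totalDegree_pderiv_lt {ι : Type*} {F : MvPolynomial ι K} {i : ι}
    (h : MvPolynomial.pderiv i F ≠ 0) :
    (MvPolynomial.pderiv i F).totalDegree < F.totalDegree := by
  classical
  rw [MvPolynomial.totalDegree, Finset.sup_lt_iff]
  · intro m hm
    have h1 : MvPolynomial.coeff (m + Finsupp.single i 1) F ≠ 0 := by
      intro h0
      rw [MvPolynomial.mem_support_iff, MvPolynomial.coeff_pderiv, h0, zero_mul] at hm
      exact hm rfl
    have := MvPolynomial.le_totalDegree (MvPolynomial.mem_support_iff.mpr h1)
    rw [Finsupp.sum_add_index' (by simp) (by simp), Finsupp.sum_single_index rfl] at this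
    exact this
  · obtain ⟨m, hm⟩ := MvPolynomial.ne_zero_iff.mp h
    have h1 : MvPolynomial.coeff (m + Finsupp.single i 1) F ≠ 0 := by
      intro h0
      rw [MvPolynomial.coeff_pderiv, h0, zero_mul] at hm
      exact hm rfl
    have := MvPolynomial.le_totalDegree (MvPolynomial.mem_support_iff.mpr h1)
    rw [Finsupp.sum_add_index' (by simp) (by simp), Finsupp.sum_single_index rfl] at this
    exact lt_of_lt_of_le (Nat.succ_pos _) this

/-- The Jacobian criterion: polynomials whose Jacobian matrix is the identity at some point are
algebraically independent. -/
theorem algebraicIndependent_of_jacobian [CharZero K] {ι : Type*} [Fintype ι] [DecidableEq ι]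
    (f : ι → MvPolynomial ι K) (x : ι → K)
    (hf : ∀ i j, MvPolynomial.eval x (MvPolynomial.pderiv j (f i)) = if i = j then 1 else 0) :
    AlgebraicIndependent K f := by
  rw [algebraicIndependent_iff]
  intro F
  induction hd : F.totalDegree using Nat.strong_induction_on generalizing F with
  | _ d ih =>
    intro hF
    let J : Matrix ι ι (MvPolynomial ι K) := Matrix.of fun i j => MvPolynomial.pderiv j (f i)
    have hJ : J.det ≠ 0 := by
      intro h0
      have h1 := congrArg (MvPolynomial.eval x) h0
      rw [RingHom.map_det, map_zero] at h1
      have h2 : (MvPolynomial.eval x).mapMatrix J = 1 := by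
        ext i j
        simp [J, hf, Matrix.one_apply]
      rw [h2, Matrix.det_one] at h1
      exact one_ne_zero h1
    -- Differentiating the relation `F(f) = 0` puts the vector of values `(∂ᵢF)(f)` in the left
    -- kernel of a nonsingular matrix. So the partial derivatives of `F` are relations too, of
    -- smaller degree unless zero.
    have hv : Matrix.vecMul (fun i => MvPolynomial.aeval f (MvPolynomial.pderiv i F)) J = 0 := by
      funext j
      have := pderiv_aeval f j F
      rw [hF, map_zero] at this
      simpa [Matrix.vecMul, dotProduct, J] using this.symm
    have h0 := Matrix.eq_zero_of_vecMul_eq_zero hJ hv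
    have hder : ∀ i, MvPolynomial.pderiv i F = 0 := by
      intro i
      by_contra hne
      exact hne (ih _ (hd ▸ totalDegree_pderiv_lt hne) _ rfl (congrFun h0 i))
    rw [eq_C_of_pderiv_eq_zero hder] at hF ⊢
    rw [MvPolynomial.aeval_C, MvPolynomial.algebraMap_eq, MvPolynomial.C_eq_zero] at hF
    rw [hF, map_zero]

/-- The derivative of a polynomial along a coordinate line on which it is affine. -/
theorem eval_pderiv_of_affine [Infinite K] {ι : Type*} [DecidableEq ι] (q : MvPolynomial ι K)
    (x : ι → K) (j : ι) (c : K)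
    (h : ∀ ε : K, MvPolynomial.eval (x + Pi.single j ε) q = MvPolynomial.eval x q + ε * c) :
    MvPolynomial.eval x (MvPolynomial.pderiv j q) = c := by
  let ℓ : ι → Polynomial K := fun i => 
    Polynomial.C (x i) + (Pi.single j Polynomial.X : ι → Polynomial K) i
  have hℓj : ℓ j = Polynomial.C (x j) + Polynomial.X := by simp [ℓ]
  have hℓi : ∀ i, i ≠ j → ℓ i = Polynomial.C (x i) := fun i hi => by simp [ℓ, hi]
  clear_value ℓ
  have hℓ : ∀ (p : MvPolynomial ι K) (ε : K),
      (MvPolynomial.aeval ℓ p).eval ε = MvPolynomial.eval (x + Pi.single j ε) p := by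
    intro p ε
    induction p using MvPolynomial.induction_on with
    | C a => simp
    | add p q hp hq => simp [hp, hq]
    | mul_X p i hp =>
      rw [map_mul, map_mul, Polynomial.eval_mul, hp, MvPolynomial.aeval_X, MvPolynomial.eval_X]
      rcases eq_or_ne i j with rfl | hij
      · simp [hℓj]
      · simp [hℓi i hij, hij]
  have hd : ∀ p : MvPolynomial ι K, Polynomial.derivative (MvPolynomial.aeval ℓ p) =
      MvPolynomial.aeval ℓ (MvPolynomial.pderiv j p) := by
    intro p
    induction p using MvPolynomial.induction_on with
    | C a => simp
    | add p q hp hq => simp [hp, hq]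
    | mul_X p i hp =>
      rw [map_mul, Polynomial.derivative_mul, hp, MvPolynomial.aeval_X, MvPolynomial.pderiv_mul,
        map_add, map_mul, map_mul, MvPolynomial.aeval_X]
      rcases eq_or_ne i j with rfl | hij
      · simp [hℓj]
      · simp [hℓi i hij, MvPolynomial.pderiv_X_of_ne hij]
  have hq : MvPolynomial.aeval ℓ q =
      Polynomial.C (MvPolynomial.eval x q) + Polynomial.C c * Polynomial.X :=
    Polynomial.funext fun ε => by rw [hℓ, h, mul_comm]; simp
  have h0 := hℓ (MvPolynomial.pderiv j q) 0
  rw [Pi.single_zero, add_zero] at h0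
  rw [← h0, ← hd, hq]
  simp

/-- A finitely generated subalgebra of a polynomial ring in `r` variables has Krull dimension at
most `r`. -/
theorem ringKrullDim_le_of_injective {A : Type*} [CommRing A] [Algebra K A]
    [Algebra.FiniteType K A] {σ : Type*} [Fintype σ] (φ : A →ₐ[K] MvPolynomial σ K)
    (hφ : Function.Injective φ) : ringKrullDim A ≤ Fintype.card σ := by
  have : IsDomain A := hφ.isDomain φ.toRingHom
  -- Noether normalization: transcendence degree bounds `s`, and incomparability of primes in an
  -- integral extension bounds the dimension of `A` by `s`.
  obtain ⟨s, g, hg, hgint⟩ := exists_integral_inj_algHom_of_fg K A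
  have hs : s ≤ Fintype.card σ := by
    have h1 := lift_trdeg_le_of_injective (φ.comp g) (hφ.comp hg)
    rw [MvPolynomial.trdeg_of_isDomain, MvPolynomial.trdeg_of_isDomain] at h1
    simpa using h1
  have hle : ringKrullDim A ≤ ringKrullDim (MvPolynomial (Fin s) K) := by
    algebraize [g.toRingHom]
    refine Order.krullDim_le_of_strictMono
      (PrimeSpectrum.comap (algebraMap (MvPolynomial (Fin s) K) A)) fun P Q hPQ => ?_
    have : Algebra.IsIntegral (MvPolynomial (Fin s) K) A := ⟨hgint⟩
    exact Ideal.IsIntegral.comap_lt_comap (R := MvPolynomial (Fin s) K) hPQ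
  refine hle.trans ?_
  rw [MvPolynomial.ringKrullDim_of_isNoetherianRing, ringKrullDim_eq_zero_of_field]
  simpa using hs

end CommutativeAlgebra

/-! ### Polynomial maps into a vector space without chosen coordinates -/

section PolynomialMaps

variable {K : Type*} [Field K] {E : Type*} [AddCommGroup E] [Module K E] {σ τ : Type*}

theorem eval_aeval {ι : Type*} (u : ι → MvPolynomial σ K) (t : σ → K) (G : MvPolynomial ι K) :
    MvPolynomial.eval t (MvPolynomial.aeval u G) =
      MvPolynomial.eval (fun a => MvPolynomial.eval t (u a)) G := by
  induction G using MvPolynomial.induction_on with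
  | C a => simp
  | add p q hp hq => rw [map_add, map_add, map_add, hp, hq]
  | mul_X p l hp =>
    rw [map_mul, map_mul, map_mul, hp, MvPolynomial.aeval_X, MvPolynomial.eval_X]

/-- A function on `K^σ` given by a polynomial. -/
def IsPolyFun (f : (σ → K) → K) : Prop :=
  ∃ q : MvPolynomial σ K, ∀ t, MvPolynomial.eval t q = f t

/-- A map from `K^σ` to a vector space whose coordinates are polynomials. -/
def IsPolyMap (h : (σ → K) → E) : Prop :=
  ∀ l : Dual K E, IsPolyFun fun t => l (h t)

theorem isPolyFun_const (c : K) : IsPolyFun fun _ : σ → K => c :=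
  ⟨MvPolynomial.C c, fun _ => by simp⟩

theorem isPolyFun_coord (i : σ) : IsPolyFun fun t : σ → K => t i :=
  ⟨MvPolynomial.X i, fun _ => by simp⟩

theorem IsPolyFun.add {f g : (σ → K) → K} (hf : IsPolyFun f) (hg : IsPolyFun g) :
    IsPolyFun fun t => f t + g t := by
  obtain ⟨p, hp⟩ := hf
  obtain ⟨q, hq⟩ := hg
  exact ⟨p + q, fun t => by simp [hp, hq]⟩

theorem IsPolyFun.mul {f g : (σ → K) → K} (hf : IsPolyFun f) (hg : IsPolyFun g) :
    IsPolyFun fun t => f t * g t := by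
  obtain ⟨p, hp⟩ := hf
  obtain ⟨q, hq⟩ := hg
  exact ⟨p * q, fun t => by simp [hp, hq]⟩

theorem IsPolyFun.sum {ι : Type*} {s : Finset ι} {f : ι → (σ → K) → K}
    (hf : ∀ i, IsPolyFun (f i)) : IsPolyFun fun t => ∑ i ∈ s, f i t := by
  choose p hp using hf
  exact ⟨∑ i ∈ s, p i, fun t => by simp [hp]⟩

theorem IsPolyFun.prod {ι : Type*} {s : Finset ι} {f : ι → (σ → K) → K}
    (hf : ∀ i, IsPolyFun (f i)) : IsPolyFun fun t => ∏ i ∈ s, f i t := by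
  choose p hp using hf
  exact ⟨∏ i ∈ s, p i, fun t => by simp [hp]⟩

theorem IsPolyFun.comp {f : (σ → K) → K} (hf : IsPolyFun f) {u : (τ → K) → σ → K}
    (hu : ∀ i, IsPolyFun fun t => u t i) : IsPolyFun fun t => f (u t) := by
  obtain ⟨p, hp⟩ := hf
  choose q hq using hu
  refine ⟨MvPolynomial.bind₁ q p, fun t => ?_⟩
  change _ = f (u t)
  rw [← hp, ← MvPolynomial.aeval_eq_bind₁, eval_aeval]
  simp only [hq]

theorem isPolyMap_const (x : E) : IsPolyMap fun _ : σ → K => x :=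
  fun l => isPolyFun_const (l x)

theorem IsPolyMap.add {g h : (σ → K) → E} (hg : IsPolyMap g) (hh : IsPolyMap h) :
    IsPolyMap fun t => g t + h t := fun l => by
  simpa using (hg l).add (hh l)

theorem IsPolyMap.smul {f : (σ → K) → K} {h : (σ → K) → E} (hf : IsPolyFun f)
    (hh : IsPolyMap h) : IsPolyMap fun t => f t • h t := fun l => by
  simpa using hf.mul (hh l)

theorem IsPolyMap.sum {ι : Type*} {s : Finset ι} {h : ι → (σ → K) → E}
    (hh : ∀ i, IsPolyMap (h i)) : IsPolyMap fun t => ∑ i ∈ s, h i t := fun l => by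
  simpa using IsPolyFun.sum fun i => hh i l

theorem IsPolyMap.comp {h : (σ → K) → E} (hh : IsPolyMap h) {u : (τ → K) → σ → K}
    (hu : ∀ i, IsPolyFun fun t => u t i) : IsPolyMap fun t => h (u t) :=
  fun l => (hh l).comp hu

theorem IsPolyMap.multilinear {V : Type*} [AddCommGroup V] [Module K V] [Module.Finite K V]
    {ι : Type*} [Fintype ι] (f : MultilinearMap K (fun _ : ι => V) E) {v : ι → (σ → K) → V}
    (hv : ∀ i, IsPolyMap (v i)) : IsPolyMap fun t => f fun i => v i t := by
  classical
  let b := finBasis K V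
  have h : (fun t => f fun i => v i t) = fun t =>
      ∑ r : ι → Fin (finrank K V), (∏ i, b.coord (r i) (v i t)) • f fun i => b (r i) := by
    funext t
    have hb : (fun i => v i t) = fun i => ∑ j, b.coord j (v i t) • b j := by
      funext i
      exact (b.sum_repr (v i t)).symm
    conv_lhs => rw [hb, MultilinearMap.map_sum]
    exact Finset.sum_congr rfl fun r _ => MultilinearMap.map_smul_univ f _ _
  rw [h]
  exact IsPolyMap.sum fun r => IsPolyMap.smul (IsPolyFun.prod fun i => hv i _) (isPolyMap_const _)

/-- The cone over a polynomial map: one more parameter scales the value. -/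
def coneMap (h : (σ → K) → E) (t : Option σ → K) : E := t none • h fun i => t (some i)

theorem IsPolyMap.coneMap {h : (σ → K) → E} (hh : IsPolyMap h) :
    IsPolyMap (coneMap h) :=
  IsPolyMap.smul (isPolyFun_coord none) (hh.comp fun i => isPolyFun_coord (some i))

/-- The homomorphism of coordinate rings of a polynomial map. -/
noncomputable def IsPolyMap.pullback {h : (σ → K) → E} (hh : IsPolyMap h) :
    MvPolynomial (Dual K E) K →ₐ[K] MvPolynomial σ K :=
  MvPolynomial.aeval fun l => (hh l).choose

theorem IsPolyMap.eval_pullback {h : (σ → K) → E} (hh : IsPolyMap h) (t : σ → K)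
    (p : MvPolynomial (Dual K E) K) :
    MvPolynomial.eval t (hh.pullback p) = evalAt K (h t) p := by
  rw [pullback, eval_aeval, evalAt]
  congr 2
  funext l
  exact (hh l).choose_spec t

theorem IsPolyMap.pullback_eq_zero_iff [Infinite K] {h : (σ → K) → E} (hh : IsPolyMap h)
    (p : MvPolynomial (Dual K E) K) : hh.pullback p = 0 ↔ ∀ t, evalAt K (h t) p = 0 := by
  simp only [← hh.eval_pullback]
  exact ⟨fun h0 t => by rw [h0, map_zero], fun h0 => MvPolynomial.funext fun t => by simp [h0]⟩

/-- The source has one variable for each linear form, in general infinitely many. The coordinate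
forms of a basis suffice, since over an infinite field a linear identity between values is one
between polynomials. -/
theorem IsPolyMap.finiteType_range_pullback [Infinite K] [Module.Finite K E] {h : (σ → K) → E}
    (hh : IsPolyMap h) : Algebra.FiniteType K hh.pullback.range := by
  rw [← Subalgebra.fg_iff_finiteType]
  let b := finBasis K E
  have hr : hh.pullback.range =
      Algebra.adjoin K (Set.range fun i => hh.pullback (MvPolynomial.X (b.coord i))) := by
    apply le_antisymm
    · rw [IsPolyMap.pullback, ← Algebra.adjoin_range_eq_range_aeval, Algebra.adjoin_le_iff]
      rintro _ ⟨l, rfl⟩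
      have hl : (hh l).choose =
          ∑ i, l (b i) • hh.pullback (MvPolynomial.X (b.coord i)) := by
        refine MvPolynomial.funext fun t => ?_
        have ht := (hh l).choose_spec t
        dsimp only at ht
        rw [ht, map_sum]
        conv_lhs => rw [← b.sum_repr (h t), map_sum]
        refine Finset.sum_congr rfl fun i _ => ?_
        rw [MvPolynomial.smul_eval, hh.eval_pullback]
        simp [evalAt, mul_comm]
      change (hh l).choose ∈ _
      rw [hl]
      exact Subalgebra.sum_mem _ fun i _ =>
        Subalgebra.smul_mem _ (Algebra.subset_adjoin (Set.mem_range_self i)) _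
    · rw [Algebra.adjoin_le_iff]
      rintro _ ⟨i, rfl⟩
      exact AlgHom.mem_range_self _ _
  rw [hr]
  exact Subalgebra.fg_def.mpr ⟨_, Set.finite_range _, rfl⟩

end PolynomialMaps

/-! ### Homogeneous equations for images of polynomial maps -/

section Homogeneous

variable {K : Type*} [Field K] {E : Type*} [AddCommGroup E] [Module K E]

/-- The values at `m` of the homogeneous components are the coefficients of the polynomial `c ↦ p(c
x)` in one variable. -/
theorem evalAt_homogeneousComponent_eq_zero [Infinite K] {p : MvPolynomial (Dual K E) K} {x : E}
    (h : ∀ c : K, evalAt K (c • x) p = 0) (m : ℕ) :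
    evalAt K x (MvPolynomial.homogeneousComponent m p) = 0 := by
  let a : ℕ → K := fun i => evalAt K x (MvPolynomial.homogeneousComponent i p)
  let P : Polynomial K := ∑ i ∈ Finset.range (p.totalDegree + 1), Polynomial.monomial i (a i)
  have hP : P = 0 := by
    refine Polynomial.funext fun c => ?_
    rw [Polynomial.eval_zero, ← h c]
    have hp : evalAt K (c • x) p = ∑ i ∈ Finset.range (p.totalDegree + 1),
        evalAt K (c • x) (MvPolynomial.homogeneousComponent i p) := by
      conv_lhs => rw [← MvPolynomial.sum_homogeneousComponent p]
      exact map_sum _ _ _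
    rw [hp]
    simp only [P, Polynomial.eval_finsetSum, Polynomial.eval_monomial]
    refine Finset.sum_congr rfl fun i _ => ?_
    have := evalAt_smul K (MvPolynomial.homogeneousComponent_isHomogeneous i p) c x
    rw [mul_comm]
    exact this.symm
  by_cases hm : m ∈ Finset.range (p.totalDegree + 1)
  · have := congrArg (fun Q => Polynomial.coeff Q m) hP
    simpa [P, Polynomial.finsetSum_coeff, Polynomial.coeff_monomial, a, hm] using this
  · rw [MvPolynomial.homogeneousComponent_eq_zero]
    · simp [evalAt]
    · rw [Finset.mem_range] at hm
      omega

/-- A polynomial map of full rank at the origin is not contained in the cone over the image of a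
polynomial map with fewer parameters, and a homogeneous polynomial witnesses this. -/
theorem exists_homogeneous_separating [CharZero K] {σ τ : Type*} [Fintype σ] [DecidableEq σ]
    [Fintype τ] (hc : Fintype.card τ < Fintype.card σ) {h : (σ → K) → E} (hh : IsPolyMap h)
    {h' : (τ → K) → E} (hh' : IsPolyMap h') (D : σ → E)
    (hD : ∀ j (ε : K), h (Pi.single j ε) = h 0 + ε • D j)
    (hli : LinearIndependent K fun o : Option σ => o.elim (h 0) D) :
    ∃ (p : MvPolynomial (Dual K E) K) (d : ℕ), p.IsHomogeneous d ∧
      (∀ t, evalAt K (h' t) p = 0) ∧ ∃ t, evalAt K (h t) p ≠ 0 := by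
  classical
  let v : Option σ → E := fun o => o.elim (h 0) D
  obtain ⟨φ, hφ⟩ := LinearMap.exists_leftInverse_of_injective (Finsupp.linearCombination K v)
    (LinearMap.ker_eq_bot.mpr hli)
  let ℓ : Option σ → Dual K E := fun a => Finsupp.lapply a ∘ₗ φ
  have hℓ : ∀ a b, ℓ a (v b) = if a = b then 1 else 0 := by
    intro a b
    have h1 := LinearMap.congr_fun hφ (Finsupp.single b 1)
    simp only [LinearMap.comp_apply, Finsupp.linearCombination_single, one_smul,
      LinearMap.id_apply] at h1
    simp [ℓ, h1, Finsupp.single_apply, eq_comm]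
  let f : Option σ → MvPolynomial (Option σ) K := fun a => (hh.coneMap (ℓ a)).choose
  let f' : Option σ → MvPolynomial (Option τ) K := fun a => (hh'.coneMap (ℓ a)).choose
  have hf : ∀ a t, MvPolynomial.eval t (f a) = ℓ a (coneMap h t) :=
    fun a => (hh.coneMap (ℓ a)).choose_spec
  have hf' : ∀ a t, MvPolynomial.eval t (f' a) = ℓ a (coneMap h' t) :=
    fun a => (hh'.coneMap (ℓ a)).choose_spec
  -- At the cone parameter 1 over the origin, the derivatives of the cone map are `h 0` and the `D
  -- j`; the forms `ℓ` are dual to them, so the Jacobian is the identity.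
  have hind : AlgebraicIndependent K f := by
    refine algebraicIndependent_of_jacobian f (fun o => o.elim 1 0) fun a b => ?_
    rw [← hℓ a b]
    refine eval_pderiv_of_affine _ _ _ _ fun ε => ?_
    rw [hf, hf, ← smul_eq_mul, ← map_smul, ← map_add]
    congr 1
    have h0 : (fun _ : σ => (0 : K)) = 0 := rfl
    cases b with
    | none => simp [coneMap, v, add_smul, h0]
    | some j =>
      have hs : (fun i => (Pi.single (some j) ε : Option σ → K) (some i)) = Pi.single j ε := by
        funext i
        simp [Pi.single_apply]
      simp [coneMap, v, h0, hs, hD]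
  -- There are `card σ + 1` polynomials in only `card τ + 1` variables.
  have hdep : ¬ AlgebraicIndependent K f' := by
    intro hcon
    have h1 := hcon.lift_cardinalMk_le_trdeg
    rw [MvPolynomial.trdeg_of_isDomain] at h1
    simp only [Cardinal.mk_fintype, Fintype.card_option, Cardinal.lift_natCast] at h1
    have h2 := Nat.cast_le.mp h1
    omega
  obtain ⟨F, hF, hF0⟩ : ∃ F, MvPolynomial.aeval f' F = 0 ∧ F ≠ 0 := by
    by_contra! hcon
    exact hdep (algebraicIndependent_iff.mpr hcon)
  obtain ⟨m, hm⟩ : ∃ m, MvPolynomial.homogeneousComponent m F ≠ 0 := by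
    by_contra! hcon
    apply hF0
    rw [← MvPolynomial.sum_homogeneousComponent F]
    exact Finset.sum_eq_zero fun i _ => hcon i
  have hren : ∀ (x : E) (G : MvPolynomial (Option σ) K),
      evalAt K x (MvPolynomial.rename ℓ G) = MvPolynomial.eval (fun a => ℓ a x) G := by
    intro x G
    rw [evalAt, MvPolynomial.eval_rename]
    rfl
  have hhom := (MvPolynomial.homogeneousComponent_isHomogeneous m F).rename_isHomogeneous (f := ℓ)
  refine ⟨_, m, hhom, fun t => ?_, ?_⟩
  · rw [MvPolynomial.rename_homogeneousComponent]
    refine evalAt_homogeneousComponent_eq_zero (fun c => ?_) m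
    have h1 := congrArg (MvPolynomial.eval fun o => o.elim c t) hF
    rw [eval_aeval, map_zero] at h1
    rw [hren, ← h1]
    congr 2
    funext a
    rw [hf']
    rfl
  · by_contra! hcon
    refine hm (hind.eq_zero_of_aeval_eq_zero _ (MvPolynomial.funext fun t => ?_))
    rw [eval_aeval, map_zero]
    simp only [hf]
    rw [← hren, coneMap, evalAt_smul K hhom, hcon, mul_zero]

end Homogeneous

/-! ### Upper and lower bounds for the dimension of parametrized projective sets -/

section DimensionBounds

variable {K : Type*} [Field K] {E : Type*} [AddCommGroup E] [Module K E] {σ : Type*}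

attribute [local instance] zariskiTopology

/-- The affine cone over a set of points of `ℙ(E)`, with its vertex. -/
def affineCone (Z : Set (ℙ K E)) : Set E :=
  {y | ∀ hy : y ≠ 0, Projectivization.mk K y hy ∈ Z}

theorem smul_mem_affineCone {Z : Set (ℙ K E)} {y : E} (hy : y ∈ affineCone Z) (c : K) :
    c • y ∈ affineCone Z := fun h0 => by
  have hy0 : y ≠ 0 := right_ne_zero_of_smul h0
  have h1 : Projectivization.mk K (c • y) h0 = Projectivization.mk K y hy0 :=
    (Projectivization.mk_eq_mk_iff' K _ _ _ _).mpr ⟨c, rfl⟩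
  rw [h1]
  exact hy hy0

theorem rep_mem_affineCone {Z : Set (ℙ K E)} {z : ℙ K E} (hz : z ∈ Z) :
    z.rep ∈ affineCone Z := fun h0 => by
  rwa [Projectivization.mk_rep]

theorem affineCone_mono {Z Z' : Set (ℙ K E)} (h : Z ⊆ Z') : affineCone Z ⊆ affineCone Z' :=
  fun _ hy h0 => h (hy h0)

/-- The ideal of the polynomials that vanish on the affine cone over `Z`. -/
noncomputable def coneIdeal (Z : Set (ℙ K E)) : Ideal (MvPolynomial (Dual K E) K) where
  carrier := {p | ∀ y ∈ affineCone Z, evalAt K y p = 0}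
  add_mem' {p q} hp hq y hy := by
    have h1 := hp y hy
    have h2 := hq y hy
    rw [evalAt] at h1 h2 ⊢
    rw [map_add, h1, h2, add_zero]
  zero_mem' y _ := map_zero _
  smul_mem' c p hp y hy := by
    have h1 := hp y hy
    rw [evalAt] at h1 ⊢
    rw [smul_eq_mul, map_mul, h1, mul_zero]

theorem mem_coneIdeal {Z : Set (ℙ K E)} {p : MvPolynomial (Dual K E) K} :
    p ∈ coneIdeal Z ↔ ∀ y ∈ affineCone Z, evalAt K y p = 0 := Iff.rfl

theorem coneIdeal_anti {Z Z' : Set (ℙ K E)} (h : Z ⊆ Z') : coneIdeal Z' ≤ coneIdeal Z :=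
  fun _ hp y hy => hp y (affineCone_mono h hy)

theorem mem_coneIdeal_iff_of_isHomogeneous {Z : Set (ℙ K E)} (hZ : Z.Nonempty)
    {p : MvPolynomial (Dual K E) K} {d : ℕ} (hp : p.IsHomogeneous d) :
    p ∈ coneIdeal Z ↔ ∀ z ∈ Z, evalAt K z.rep p = 0 := by
  refine ⟨fun h z hz => h _ (rep_mem_affineCone hz), fun h y hy => ?_⟩
  by_cases hy0 : y = 0
  · obtain ⟨z, hz⟩ := hZ
    rw [hy0, ← zero_smul K z.rep, evalAt_smul K hp, h z hz, mul_zero]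
  · obtain ⟨a, ha⟩ := Projectivization.exists_smul_eq_mk_rep K y hy0
    have h1 := h _ (hy hy0)
    rw [← ha, Units.smul_def, evalAt_smul K hp] at h1
    exact (mul_eq_zero.mp h1).resolve_left (pow_ne_zero _ a.ne_zero)

theorem isClosed_evalAt_eq_zero {p : MvPolynomial (Dual K E) K} {d : ℕ} (hp : p.IsHomogeneous d) :
    IsClosed {x : ℙ K E | evalAt K x.rep p = 0} := by
  rw [isClosed_zariski_iff]
  exact ⟨{p}, fun q hq => ⟨d, hq ▸ hp⟩, by ext x; simp [projZeroLocus]⟩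

theorem coneIdeal_ne_top (Z : Set (ℙ K E)) : coneIdeal Z ≠ ⊤ := by
  intro h
  have h1 := mem_coneIdeal.mp ((Ideal.eq_top_iff_one _).mp h) 0 fun h0 => (h0 rfl).elim
  rw [evalAt, map_one] at h1
  exact one_ne_zero h1

theorem coneIdeal_empty_isPrime : (coneIdeal (∅ : Set (ℙ K E))).IsPrime := by
  have h0 : ∀ p : MvPolynomial (Dual K E) K, p ∈ coneIdeal ∅ ↔ evalAt K (0 : E) p = 0 := by
    intro p
    refine ⟨fun h => h 0 fun h0 => (h0 rfl).elim, fun h y hy => ?_⟩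
    have hy0 : y = 0 := by
      by_contra hne
      exact hy hne
    rwa [hy0]
  refine ⟨coneIdeal_ne_top _, fun {x y} hxy => ?_⟩
  rw [h0] at hxy ⊢
  rw [h0]
  rw [evalAt, map_mul] at hxy
  exact mul_eq_zero.mp hxy

/-- The ideal is homogeneous because the cone is stable under scaling, so primality need only be
tested on homogeneous elements. Their zero loci are closed, and irreducibility applies. -/
theorem coneIdeal_isPrime [Infinite K] {Z : Set (ℙ K E)} (hZ : IsIrreducible Z) :
    (coneIdeal Z).IsPrime := by
  classical
  let _ := MvPolynomial.gradedAlgebra (σ := Dual K E) (R := K)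
  have hhom : (coneIdeal Z).IsHomogeneous (MvPolynomial.homogeneousSubmodule (Dual K E) K) := by
    intro m p hp
    have heq : (DirectSum.decompose (MvPolynomial.homogeneousSubmodule (Dual K E) K) p m :
        MvPolynomial (Dual K E) K) = MvPolynomial.homogeneousComponent m p :=
      MvPolynomial.decomposition.decompose'_apply p m
    rw [heq]
    exact fun y hy => evalAt_homogeneousComponent_eq_zero
      (fun c => hp _ (smul_mem_affineCone hy c)) m
  refine hhom.isPrime_of_homogeneous_mem_or_mem (coneIdeal_ne_top _) ?_
  rintro p q ⟨a, ha⟩ ⟨b, hb⟩ hpq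
  rw [MvPolynomial.mem_homogeneousSubmodule] at ha hb
  rw [mem_coneIdeal_iff_of_isHomogeneous hZ.nonempty ha,
    mem_coneIdeal_iff_of_isHomogeneous hZ.nonempty hb]
  rw [mem_coneIdeal_iff_of_isHomogeneous hZ.nonempty (ha.mul hb)] at hpq
  refine isPreirreducible_iff_isClosed_union_isClosed.mp hZ.isPreirreducible _ _
    (isClosed_evalAt_eq_zero ha) (isClosed_evalAt_eq_zero hb) fun z hz => ?_
  have := hpq z hz
  rw [evalAt, map_mul] at this
  exact mul_eq_zero.mp this

theorem coneIdeal_lt_empty {Z : Set (ℙ K E)} (hZ : Z.Nonempty) :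
    coneIdeal Z < coneIdeal ∅ := by
  obtain ⟨z, hz⟩ := hZ
  refine lt_of_le_of_ne (coneIdeal_anti (Set.empty_subset _)) fun heq => ?_
  obtain ⟨l, hl⟩ : ∃ l : Dual K E, l z.rep ≠ 0 := by
    by_contra! hcon
    exact z.rep_nonzero ((Module.forall_dual_apply_eq_zero_iff K _).mp hcon)
  have h1 : MvPolynomial.X l ∈ coneIdeal (∅ : Set (ℙ K E)) := by
    intro y hy
    have hy0 : y = 0 := by
      by_contra hne
      exact hy hne
    simp [evalAt, hy0]
  rw [← heq] at h1
  have h2 := h1 _ (rep_mem_affineCone hz)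
  rw [evalAt, MvPolynomial.eval_X] at h2
  exact hl h2

/-- A set closed in `X` is recovered from the homogeneous polynomials in its ideal, so distinct
closed sets have distinct ideals. -/
theorem coneIdeal_lt_of_lt {X : Set (ℙ K E)} {Z Z' : TopologicalSpace.IrreducibleCloseds X}
    (h : Z < Z') :
    coneIdeal (Subtype.val '' (Z' : Set X)) < coneIdeal (Subtype.val '' (Z : Set X)) := by
  have hle : (Z : Set X) ⊆ Z' := h.le
  refine lt_of_le_of_ne (coneIdeal_anti (Set.image_mono hle)) fun heq => h.ne ?_
  refine le_antisymm h.le fun z hz => ?_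
  obtain ⟨C, hC, hCZ⟩ := isClosed_induced_iff.mp Z.isClosed
  rw [isClosed_zariski_iff] at hC
  obtain ⟨S, hS, rfl⟩ := hC
  change z ∈ (Z : Set X)
  rw [← hCZ]
  intro p hp
  obtain ⟨d, hd⟩ := hS p hp
  have h1 : p ∈ coneIdeal (Subtype.val '' (Z : Set X)) := by
    rw [mem_coneIdeal_iff_of_isHomogeneous (Z.isIrreducible.nonempty.image _) hd]
    rintro _ ⟨w, hw, rfl⟩
    rw [← hCZ] at hw
    exact hw p hp
  rw [← heq] at h1
  exact h1 _ (rep_mem_affineCone ⟨z, hz, rfl⟩)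

/-- A set of points in the closure of the image of a polynomial map with `r` parameters has
dimension at most `r`. -/
theorem zariskiDim_le_card [Infinite K] [Module.Finite K E] [Fintype σ] {X : Set (ℙ K E)}
    (hX0 : X.Nonempty) {h : (σ → K) → E} (hh : IsPolyMap h)
    (hX : ∀ (p : MvPolynomial (Dual K E) K) (d : ℕ), p.IsHomogeneous d →
      (∀ t, evalAt K (h t) p = 0) → ∀ x ∈ X, evalAt K x.rep p = 0) :
    zariskiDim K X ≤ Fintype.card σ := by
  let φ := hh.coneMap.pullback
  have hker : ∀ Z ⊆ X, RingHom.ker φ ≤ coneIdeal Z := by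
    intro Z hZ
    refine le_trans (fun p hp => ?_) (coneIdeal_anti hZ)
    rw [RingHom.mem_ker, hh.coneMap.pullback_eq_zero_iff] at hp
    have hm : ∀ m, MvPolynomial.homogeneousComponent m p ∈ coneIdeal X := by
      intro m
      have hd := MvPolynomial.homogeneousComponent_isHomogeneous m p
      rw [mem_coneIdeal_iff_of_isHomogeneous hX0 hd]
      refine hX _ m hd fun t => evalAt_homogeneousComponent_eq_zero (fun c => ?_) m
      have h1 : coneMap h (fun o => o.elim c t) = c • h t := rfl
      rw [← h1]
      exact hp _
    rw [← MvPolynomial.sum_homogeneousComponent p]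
    exact Ideal.sum_mem _ fun m _ => hm m
  have hirr : ∀ Z : TopologicalSpace.IrreducibleCloseds X,
      IsIrreducible (Subtype.val '' (Z : Set X) : Set (ℙ K E)) :=
    fun Z => Z.isIrreducible.image _ continuous_subtype_val.continuousOn
  -- The added bottom goes to the ideal of the vertex, strictly above all the others. It lengthens
  -- every chain by one, which offsets the extra parameter of the cone.
  let F : WithBot (TopologicalSpace.IrreducibleCloseds X) →
      (PrimeSpectrum.zeroLocus (RingHom.ker φ : Set (MvPolynomial (Dual K E) K)))ᵒᵈ :=
    WithBot.recBotCoe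
      (OrderDual.toDual ⟨⟨_, coneIdeal_empty_isPrime⟩, hker _ (Set.empty_subset _)⟩)
      fun Z => OrderDual.toDual ⟨⟨_, coneIdeal_isPrime (hirr Z)⟩,
        hker _ (Subtype.coe_image_subset _ _)⟩
  have hF : StrictMono F := by
    intro Z Z' hlt
    induction Z' with
    | bot => exact (not_lt_bot hlt).elim
    | coe Z' =>
      induction Z with
      | bot => exact coneIdeal_lt_empty (hirr Z').nonempty
      | coe Z => exact coneIdeal_lt_of_lt (WithBot.coe_lt_coe.mp hlt)
  have h1 := Order.krullDim_le_of_strictMono F hF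
  rw [Order.krullDim_orderDual, ← ringKrullDim_quotient] at h1
  have hft : Algebra.FiniteType K (MvPolynomial (Dual K E) K ⧸ RingHom.ker φ) :=
    (hh.coneMap.finiteType_range_pullback).equiv (Ideal.quotientKerEquivRange φ).symm
  have h2 := h1.trans (ringKrullDim_le_of_injective (Ideal.kerLiftAlg φ)
    (Ideal.kerLiftAlg_injective φ))
  obtain ⟨x, hx⟩ := hX0
  have : Nonempty (TopologicalSpace.IrreducibleCloseds X) :=
    ⟨⟨closure {⟨x, hx⟩}, isIrreducible_singleton.closure, isClosed_closure⟩⟩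
  rw [Order.krullDim_withBot, Fintype.card_option, Nat.cast_add, Nat.cast_one] at h2
  exact ENat.WithBot.add_le_add_one_right_iff.mp h2

/-- The points of `ℙ(E)` given by the nonzero values of a map. -/
def projImage (h : (σ → K) → E) : Set (ℙ K E) :=
  {x | ∃ t, ∃ ht : h t ≠ 0, x = Projectivization.mk K (h t) ht}

theorem evalAt_rep_mk_eq_zero_iff {p : MvPolynomial (Dual K E) K} {d : ℕ} (hp : p.IsHomogeneous d)
    {y : E} (hy : y ≠ 0) :
    evalAt K (Projectivization.mk K y hy).rep p = 0 ↔ evalAt K y p = 0 := by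
  have := mk_mem_projZeroLocus K (S := {p}) (fun q hq => ⟨d, hq ▸ hp⟩) y hy
  simpa [projZeroLocus] using this

theorem isPreirreducible_projImage [Infinite K] {h : (σ → K) → E} (hh : IsPolyMap h) :
    IsPreirreducible (projImage h) := by
  rw [isPreirreducible_iff_isClosed_union_isClosed]
  intro A B hA hB hAB
  rw [isClosed_zariski_iff] at hA hB
  obtain ⟨S, hS, rfl⟩ := hA
  obtain ⟨T, hT, rfl⟩ := hB
  by_contra! hcon
  obtain ⟨⟨_, ⟨s, hs, rfl⟩, hsA⟩, ⟨_, ⟨t, ht, rfl⟩, htB⟩⟩ :=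
    And.imp Set.not_subset.mp Set.not_subset.mp hcon
  rw [mk_mem_projZeroLocus K hS] at hsA
  rw [mk_mem_projZeroLocus K hT] at htB
  push Not at hsA htB
  obtain ⟨p, hp, hps⟩ := hsA
  obtain ⟨q, hq, hqt⟩ := htB
  obtain ⟨l, hl⟩ : ∃ l : Dual K E, l (h s) ≠ 0 := by
    by_contra! hcon
    exact hs ((Module.forall_dual_apply_eq_zero_iff K _).mp hcon)
  -- The third factor keeps the common nonvanishing point `u` away from the zeros of `h`, so that it
  -- defines a point of `ℙ(E)`.
  have hne : hh.pullback p * hh.pullback q * hh.pullback (MvPolynomial.X l) ≠ 0 := by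
    refine mul_ne_zero (mul_ne_zero ?_ ?_) ?_
    · exact fun h0 => hps ((hh.pullback_eq_zero_iff p).mp h0 s)
    · exact fun h0 => hqt ((hh.pullback_eq_zero_iff q).mp h0 t)
    · intro h0
      have := (hh.pullback_eq_zero_iff _).mp h0 s
      rw [evalAt, MvPolynomial.eval_X] at this
      exact hl this
  obtain ⟨u, hu⟩ : ∃ u, MvPolynomial.eval u
      (hh.pullback p * hh.pullback q * hh.pullback (MvPolynomial.X l)) ≠ 0 := by
    by_contra! hcon
    exact hne (MvPolynomial.funext fun u => by rw [hcon, map_zero])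
  simp only [map_mul, hh.eval_pullback, mul_ne_zero_iff] at hu
  obtain ⟨⟨hpu, hqu⟩, hlu⟩ := hu
  have hu0 : h u ≠ 0 := by
    intro h0
    simp [evalAt, h0] at hlu
  rcases hAB ⟨u, hu0, rfl⟩ with hA | hB
  · exact hpu ((mk_mem_projZeroLocus K hS _ hu0).mp hA p hp)
  · exact hqu ((mk_mem_projZeroLocus K hT _ hu0).mp hB q hq)

/-- Extension by zero from a coordinate subspace. -/
def extendByZero (P : σ → Prop) [DecidablePred P] (t : {i // P i} → K) (i : σ) : K :=
  if hi : P i then t ⟨i, hi⟩ else 0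

theorem isPolyFun_extendByZero (P : σ → Prop) [DecidablePred P] (i : σ) :
    IsPolyFun fun t : {i // P i} → K => extendByZero P t i := by
  unfold extendByZero
  split_ifs with hi
  · exact isPolyFun_coord _
  · exact isPolyFun_const _

theorem extendByZero_single [DecidableEq σ] (P : σ → Prop) [DecidablePred P] (j : {i // P i})
    (ε : K) : extendByZero P (Pi.single j ε) = Pi.single (j : σ) ε := by
  funext i
  unfold extendByZero
  split_ifs with hi
  · simp [Pi.single_apply, Subtype.ext_iff]
  · rw [Pi.single_eq_of_ne]
    rintro rfl
    exact hi j.2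

theorem extendByZero_zero (P : σ → Prop) [DecidablePred P] :
    extendByZero P (0 : {i // P i} → K) = 0 := by
  funext i
  simp [extendByZero]

theorem projImage_extendByZero_mono (h : (σ → K) → E) {P Q : σ → Prop} [DecidablePred P]
    [DecidablePred Q] (hPQ : ∀ i, P i → Q i) :
    projImage (fun t => h (extendByZero P t)) ⊆ projImage fun t => h (extendByZero Q t) := by
  rintro _ ⟨t, ht, rfl⟩
  have he : extendByZero Q (fun i => extendByZero P t i) = extendByZero P t := by
    funext i
    by_cases hi : Q i
    · simp [extendByZero, hi]
    · have hi' : ¬ P i := fun hp => hi (hPQ i hp)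
      simp [extendByZero, hi, hi']
  exact ⟨fun i => extendByZero P t i, by simpa only [he] using ht, by simp only [he]⟩

/-- A set of points that contains the image of a polynomial map of full rank at the origin has
dimension at least the number of parameters. -/
theorem card_le_zariskiDim [CharZero K] [Fintype σ] [DecidableEq σ] {X : Set (ℙ K E)}
    {h : (σ → K) → E} (hh : IsPolyMap h) (D : σ → E)
    (hD : ∀ j (ε : K), h (Pi.single j ε) = h 0 + ε • D j)
    (hli : LinearIndependent K fun o : Option σ => o.elim (h 0) D)
    (hX : projImage h ⊆ X) : (Fintype.card σ : WithBot ℕ∞) ≤ zariskiDim K X := by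
  let e := Fintype.equivFin σ
  -- The restrictions of `h` to a full flag of coordinate subspaces; the closures of their images
  -- form the chain.
  let g : (j : ℕ) → ({i // (e i : ℕ) < j} → K) → E := fun j t => h (extendByZero _ t)
  have hg : ∀ j, IsPolyMap (g j) := fun j => hh.comp (isPolyFun_extendByZero _)
  have hgX : ∀ j, projImage (g j) ⊆ X := by
    rintro j _ ⟨t, ht, rfl⟩
    exact hX ⟨_, ht, rfl⟩
  have hg0 : ∀ j, g j 0 = h 0 := fun j => congrArg h (extendByZero_zero _)
  have hne : h 0 ≠ 0 := hli.ne_zero none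
  have hirr : ∀ j, IsIrreducible (Subtype.val ⁻¹' projImage (g j) : Set X) := by
    intro j
    have hg0' : g j 0 ≠ 0 := by rwa [hg0]
    refine ⟨⟨⟨_, hgX j ⟨0, hg0', rfl⟩⟩, ⟨0, hg0', rfl⟩⟩, ?_⟩
    have himg : (Subtype.val '' (Subtype.val ⁻¹' projImage (g j) : Set X)) = projImage (g j) := by
      rw [Subtype.image_preimage_coe, Set.inter_eq_right]
      exact hgX j
    have h1 := isPreirreducible_projImage (hg j)
    rw [isPreirreducible_iff_isClosed_union_isClosed] at h1 ⊢
    intro A B hA hB hAB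
    obtain ⟨A', hA', rfl⟩ := isClosed_induced_iff.mp hA
    obtain ⟨B', hB', rfl⟩ := isClosed_induced_iff.mp hB
    have h2 := h1 A' B' hA' hB'
    rw [← himg] at h2
    simpa only [← Set.preimage_union, Set.image_subset_iff] using
      h2 (by rwa [Set.image_subset_iff])
  let Z : ℕ → TopologicalSpace.IrreducibleCloseds X := fun j =>
    ⟨closure (Subtype.val ⁻¹' projImage (g j)), (hirr j).closure, isClosed_closure⟩
  have hlt : ∀ j < Fintype.card σ, Z j < Z (j + 1) := by
    intro j hj
    have hle : Z j ≤ Z (j + 1) := closure_mono <| Set.preimage_mono <|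
      projImage_extendByZero_mono h fun i hi => Nat.lt_succ_of_lt hi
    refine lt_of_le_of_ne hle fun heq => ?_
    have hcard : Fintype.card {i // (e i : ℕ) < j} < Fintype.card {i // (e i : ℕ) < j + 1} := by
      rw [Fintype.card_subtype, Fintype.card_subtype]
      refine Finset.card_lt_card (Finset.ssubset_iff_of_subset ?_ |>.mpr ?_)
      · intro i hi
        simp only [Finset.mem_filter, Finset.mem_univ, true_and] at hi ⊢
        omega
      · exact ⟨e.symm ⟨j, hj⟩, by simp, by simp⟩
    obtain ⟨p, d, hpd, hp0, t, hpt⟩ := exists_homogeneous_separating hcard (hg (j + 1)) (hg j)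
      (fun i => D i)
      (fun i ε => by
        have h1 := congrArg h (extendByZero_single (fun i => (e i : ℕ) < j + 1) i ε)
        rw [hg0, ← hD]
        exact h1)
      (by
        have h1 := hli.comp (Option.map Subtype.val)
          (Option.map_injective (Subtype.val_injective (p := fun i => (e i : ℕ) < j + 1)))
        convert h1 using 1
        funext o
        cases o with
        | none => exact hg0 _
        | some i => rfl)
    by_cases ht0 : g (j + 1) t = 0
    · apply hpt
      rw [ht0, ← zero_smul K (g j 0), evalAt_smul K hpd, hp0, mul_zero]
    · have hx : Projectivization.mk K _ ht0 ∈ projImage (g (j + 1)) := ⟨t, ht0, rfl⟩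
      have hcl : IsClosed (Subtype.val ⁻¹' {x : ℙ K E | evalAt K x.rep p = 0} : Set X) :=
        (isClosed_evalAt_eq_zero hpd).preimage continuous_subtype_val
      have hsub : (Z j : Set X) ⊆ Subtype.val ⁻¹' {x : ℙ K E | evalAt K x.rep p = 0} := by
        refine closure_minimal (Set.preimage_mono ?_) hcl
        rintro _ ⟨s, hs, rfl⟩
        exact (evalAt_rep_mk_eq_zero_iff hpd hs).mpr (hp0 s)
      have hmem : (⟨_, hgX (j + 1) hx⟩ : X) ∈ (Z (j + 1) : Set X) := subset_closure hx
      rw [← heq] at hmem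
      have h3 := hsub hmem
      rw [Set.mem_preimage, Set.mem_ofPred_eq] at h3
      exact hpt ((evalAt_rep_mk_eq_zero_iff hpd ht0).mp h3)
  let c : LTSeries (TopologicalSpace.IrreducibleCloseds X) :=
    { length := Fintype.card σ
      toFun := fun j => Z j
      step := fun j => hlt j j.2 }
  exact Order.LTSeries.length_le_krullDim c

end DimensionBounds

/-! ### Combinatorics of the tangent wedges at a coordinate subspace -/

section TangentIndex

variable {k : ℕ} {κ : Type*}

/-- The indices of the vectors of `b` in the wedges that span the tangent space at the origin of
the big cell, cone direction included. -/
def tangentIndex : Option (Fin k × κ) → Fin k → Fin k ⊕ κ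
  | none => Sum.inl
  | some x => Function.update Sum.inl x.1 (Sum.inr x.2)

theorem tangentIndex_injective (x : Option (Fin k × κ)) :
    Function.Injective (tangentIndex x) := by
  cases x with
  | none => exact Sum.inl_injective
  | some x =>
    intro i j hij
    simp only [tangentIndex, Function.update_apply] at hij
    split_ifs at hij with h1 h2 h2
    · rw [h1, h2]
    · exact Sum.inl_injective hij

theorem exists_tangentIndex_eq_inl (x : Option (Fin k × κ)) (hk : 0 < k) :
    ∃ i₀, ∀ i, i ≠ i₀ → tangentIndex x i = Sum.inl i := by
  cases x with
  | none => exact ⟨⟨0, hk⟩, fun _ _ => rfl⟩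
  | some x => exact ⟨x.1, fun i hi => Function.update_of_ne hi _ _⟩

/-- One index outside the other range is enough for independence: it produces a zero column in the
determinant that pairs the two wedges. -/
theorem exists_tangentIndex_notMem_range {x y : Option (Fin k × κ)} (hxy : x ≠ y) :
    ∃ i, tangentIndex x i ∉ Set.range (tangentIndex y) := by
  have hinr : ∀ (i : Fin k) (j : κ), tangentIndex (some (i, j)) i = Sum.inr j :=
    fun i j => Function.update_self _ _ _
  have hinl : ∀ (i : Fin k) (j : κ), Sum.inl i ∉ Set.range (tangentIndex (some (i, j))) := by
    rintro i j ⟨l, hl⟩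
    simp only [tangentIndex, Function.update_apply] at hl
    split_ifs at hl with h1
    exact h1 (Sum.inl_injective hl)
  have hran : ∀ (i : Fin k) (j j' : κ), Sum.inr j' ∈ Set.range (tangentIndex (some (i, j))) →
      j' = j := by
    rintro i j j' ⟨l, hl⟩
    simp only [tangentIndex, Function.update_apply] at hl
    split_ifs at hl with h1
    exact (Sum.inr_injective hl).symm
  match x, y, hxy with
  | none, none, h => exact (h rfl).elim
  | none, some (i, j), _ => exact ⟨i, hinl i j⟩
  | some (i, j), none, _ =>
    refine ⟨i, ?_⟩
    rw [hinr]
    rintro ⟨l, hl⟩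
    exact Sum.inl_ne_inr hl
  | some (i, j), some (i', j'), h =>
    by_cases hj : j = j'
    · subst hj
      have hi : i' ≠ i := fun h' => h (by rw [h'])
      refine ⟨i', ?_⟩
      have h1 : tangentIndex (some (i, j)) i' = Sum.inl i' := Function.update_of_ne hi _ _
      rw [h1]
      exact hinl i' j
    · exact ⟨i, fun hm => hj (hran _ _ _ (hinr i j ▸ hm))⟩

end TangentIndex

/-! ### Big cells of the Grassmannian -/

section Charts

variable {K : Type*} [Field K] {V : Type*} [AddCommGroup V] [Module K V]

/-- The vectors `u` need not be independent: pulled back to `K^k`, an alternating map in `k`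
arguments is a multiple of the determinant. -/
theorem alternatingMap_sum_smul {E : Type*} [AddCommGroup E] [Module K E] {k : ℕ}
    (f : V [⋀^Fin k]→ₗ[K] E) (M : Matrix (Fin k) (Fin k) K) (u : Fin k → V) :
    f (fun i => ∑ j, M i j • u j) = M.det • f u := by
  let e := Pi.basisFun K (Fin k)
  let L := Fintype.linearCombination K u
  let g₁ : (Fin k → K) [⋀^Fin k]→ₗ[K] E := f.compLinearMap L
  let g₂ : (Fin k → K) [⋀^Fin k]→ₗ[K] E :=
    (LinearMap.toSpanSingleton K _ (g₁ e)).compAlternatingMap e.det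
  have hg : g₁ = g₂ := by
    refine Basis.ext_alternating e fun i h => ?_
    let σ : Equiv.Perm (Fin k) := Equiv.ofBijective i (Finite.injective_iff_bijective.1 h)
    change g₁ (e ∘ σ) = e.det (e ∘ σ) • g₁ e
    rw [AlternatingMap.map_perm, AlternatingMap.map_perm, Basis.det_self]
    simp
  have h1 : g₁ (fun i => M i) = e.det (fun i => M i) • g₁ e :=
    DFunLike.congr_fun hg fun i => M i
  have h2 : g₁ e = f u := by
    refine congrArg f (funext fun i => ?_)
    simp [L, e, Fintype.linearCombination_apply, Pi.single_apply]
  rw [h2, Pi.basisFun_det_apply] at h1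
  exact h1

variable {k : ℕ} {κ : Type*} [Fintype κ] (b : Basis (Fin k ⊕ κ) K V)

/-- The basis, in reduced row echelon form, of a subspace in the big cell given by `b`. -/
noncomputable def chartVec (a : Fin k × κ → K) (i : Fin k) : V :=
  b (Sum.inl i) + ∑ j, a (i, j) • b (Sum.inr j)

/-- The big cell of the Grassmannian in Plücker coordinates. -/
noncomputable def chart (a : Fin k × κ → K) : ⋀[K]^k V :=
  exteriorPower.ιMulti K k (chartVec b a)

theorem isPolyMap_chart [Module.Finite K V] : IsPolyMap (chart b) :=
  IsPolyMap.multilinear (exteriorPower.ιMulti K k).toMultilinearMap fun i =>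
    (isPolyMap_const _).add <| IsPolyMap.sum fun j =>
      IsPolyMap.smul (isPolyFun_coord (i, j)) (isPolyMap_const _)

theorem linearIndependent_chartVec (a : Fin k × κ → K) : LinearIndependent K (chartVec b a) := by
  classical
  refine LinearIndependent.of_pairwise_dual_eq_zero_one _ (fun i => b.coord (Sum.inl i)) ?_ ?_
  · intro i j hij
    simp [chartVec, hij.symm]
  · intro i
    simp [chartVec]

theorem chart_zero : chart b 0 = exteriorPower.ιMulti K k (b ∘ tangentIndex none) := by
  refine congrArg (exteriorPower.ιMulti K k) (funext fun i => ?_)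
  simp [chartVec, tangentIndex]

theorem option_elim_chart_zero (b : Basis (Fin k ⊕ κ) K V) :
    (fun o : Option (Fin k × κ) => o.elim (chart b 0)
      fun x => exteriorPower.ιMulti K k (b ∘ tangentIndex (some x))) =
    fun o => exteriorPower.ιMulti K k (b ∘ tangentIndex o) := by
  funext o
  cases o with
  | none => exact chart_zero b
  | some x => rfl

/-- One matrix entry alters one factor of the wedge, so multilinearity makes the chart exactly
affine along each coordinate axis. -/
theorem chart_single [DecidableEq κ] (x : Fin k × κ) (ε : K) :
    chart b (Pi.single x ε) =
      chart b 0 + ε • exteriorPower.ιMulti K k (b ∘ tangentIndex (some x)) := by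
  have h1 : chartVec b (Pi.single x ε) =
      Function.update (b ∘ Sum.inl) x.1 (b (Sum.inl x.1) + ε • b (Sum.inr x.2)) := by
    funext i
    rcases eq_or_ne i x.1 with rfl | hi
    · rw [Function.update_self, chartVec, Finset.sum_eq_single x.2]
      · simp
      · intro j _ hj
        simp [Prod.ext_iff, hj]
      · simp
    · simp [chartVec, Prod.ext_iff, hi]
  have h2 : b ∘ tangentIndex (some x) = Function.update (b ∘ Sum.inl) x.1 (b (Sum.inr x.2)) := by
    rw [tangentIndex, Function.comp_update]
  rw [chart_zero, chart, h1, h2, AlternatingMap.map_update_add, AlternatingMap.map_update_smul]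
  congr 2
  exact Function.update_eq_self x.1 (b ∘ Sum.inl)

/-- A family of vectors can be moved into the big cell by a generic perturbation. -/
theorem exists_perturbation_eq_chart (v : Fin k → V) :
    ∃ χ : Polynomial K, χ ≠ 0 ∧ ∀ t : K, χ.eval t ≠ 0 → ∃ c : K, c ≠ 0 ∧ ∃ a,
      exteriorPower.ιMulti K k (fun i => v i + t • b (Sum.inl i)) = c • chart b a := by
  classical
  let M₀ : Matrix (Fin k) (Fin k) K := Matrix.of fun i j => b.coord (Sum.inl j) (v i)
  -- At `t` this takes the value `det (t + M₀)`, the determinant of the first-block coefficients of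
  -- the perturbed vectors. Where it is nonzero, multiplying by the inverse matrix gives the reduced
  -- echelon form.
  refine ⟨(-M₀).charpoly, (Matrix.charpoly_monic _).ne_zero, fun t ht => ?_⟩
  rw [Matrix.eval_charpoly, sub_neg_eq_add] at ht
  set M := Matrix.scalar (Fin k) t + M₀ with hM
  let w : Fin k → V := fun i => v i + t • b (Sum.inl i)
  have hMw : ∀ i j, M i j = b.coord (Sum.inl j) (w i) := by
    intro i j
    simp [hM, M₀, w, Matrix.diagonal_apply, Finsupp.single_apply, add_comm]
  have hdet : IsUnit M.det := isUnit_iff_ne_zero.mpr ht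
  let u : Fin k → V := fun i => ∑ j, M⁻¹ i j • w j
  have hwu : ∀ i, w i = ∑ j, M i j • u j := by
    intro i
    have h1 := congrFun (congrArg (fun N : Matrix (Fin k) (Fin k) K => N i)
      (Matrix.mul_nonsing_inv M hdet))
    simp only [u, Finset.smul_sum, smul_smul]
    rw [Finset.sum_comm]
    simp only [← Finset.sum_smul]
    simp only [Matrix.mul_apply] at h1
    simp [h1, Matrix.one_apply]
  refine ⟨M.det, ht, fun x => b.coord (Sum.inr x.2) (u x.1), ?_⟩
  have hu : chartVec b (fun x => b.coord (Sum.inr x.2) (u x.1)) = u := by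
    funext i
    have h2 : ∀ j, b.coord (Sum.inl j) (u i) = if i = j then 1 else 0 := by
      intro j
      have h1 := congrFun (congrFun (Matrix.nonsing_inv_mul M hdet) i) j
      simp only [u, map_sum, map_smul, smul_eq_mul, ← hMw]
      rw [← Matrix.one_apply, ← h1, Matrix.mul_apply]
    conv_rhs => rw [← b.sum_repr (u i), Fintype.sum_sum_type]
    simp only [chartVec, ← b.coord_apply, h2]
    simp
  rw [chart, hu, ← alternatingMap_sum_smul]
  exact congrArg _ (funext hwu)

end Charts

/-! ### Independence of the tangent spaces at two points -/

section Wedges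

variable {K : Type*} [Field K] {V : Type*} [AddCommGroup V] [Module K V]

/-- Wedges of vectors of a basis are linearly independent if they involve different sets of
vectors. -/
theorem linearIndependent_wedge_basis {ι α : Type*} (b : Basis ι K V) {k : ℕ}
    (R : α → Fin k → ι) (hR : ∀ x, Function.Injective (R x))
    (hne : ∀ x y, x ≠ y → ∃ i, R x i ∉ Set.range (R y)) :
    LinearIndependent K fun x => exteriorPower.ιMulti K k (b ∘ R x) := by
  classical
  refine LinearIndependent.of_pairwise_dual_eq_zero_one _ (fun x =>
    exteriorPower.pairingDual K V k (exteriorPower.ιMulti K k fun i => b.coord (R x i))) ?_ ?_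
  · intro x y hxy
    obtain ⟨i, hi⟩ := hne x y hxy
    rw [exteriorPower.pairingDual_ιMulti_ιMulti]
    refine Matrix.det_eq_zero_of_column_eq_zero i fun j => ?_
    have : R y j ≠ R x i := fun h => hi ⟨j, h⟩
    simp [Finsupp.single_apply, this]
  · intro x
    rw [exteriorPower.pairingDual_ιMulti_ιMulti, ← Matrix.det_one (n := Fin k)]
    congr 1
    ext i j
    simp [Finsupp.single_apply, Matrix.one_apply, (hR x).eq_iff]

/-- The permutation of the index set that exchanges the first two blocks. -/
def swapBlocks (k : ℕ) (μ : Type*) : Fin k ⊕ (Fin k ⊕ μ) ≃ Fin k ⊕ (Fin k ⊕ μ) :=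
  ((Equiv.sumAssoc _ _ _).symm.trans ((Equiv.sumComm _ _).sumCongr (Equiv.refl _))).trans
    (Equiv.sumAssoc _ _ _)

theorem swapBlocks_symm_inl (k : ℕ) (μ : Type*) (i : Fin k) :
    (swapBlocks k μ).symm (Sum.inl i) = Sum.inr (Sum.inl i) := rfl

/-- Terracini's condition: the tangent spaces of the cone over the Grassmannian at two points in
general position are independent if `k ≥ 3`. -/
theorem linearIndependent_tangents {k : ℕ} (hk : 3 ≤ k) {μ : Type*}
    (b : Basis (Fin k ⊕ (Fin k ⊕ μ)) K V) :
    LinearIndependent K (Sum.elim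
      (fun x => exteriorPower.ιMulti K k (b ∘ tangentIndex x))
      (fun x => exteriorPower.ιMulti K k (b.reindex (swapBlocks k μ) ∘ tangentIndex x))) := by
  let R : Option (Fin k × (Fin k ⊕ μ)) ⊕ Option (Fin k × (Fin k ⊕ μ)) →
      Fin k → Fin k ⊕ (Fin k ⊕ μ) :=
    Sum.elim tangentIndex fun x => (swapBlocks k μ).symm ∘ tangentIndex x
  -- This is where `k ≥ 3` is needed: two positions must remain once the exceptional one is removed.
  have hpick : ∀ i₀ : Fin k, ∃ i j, i ≠ i₀ ∧ j ≠ i₀ ∧ i ≠ j := by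
    intro i₀
    by_contra! hcon
    have h0 := hcon ⟨0, by omega⟩ ⟨1, by omega⟩
    have h1 := hcon ⟨1, by omega⟩ ⟨2, by omega⟩
    have h2 := hcon ⟨0, by omega⟩ ⟨2, by omega⟩
    simp only [ne_eq, Fin.ext_iff] at h0 h1 h2
    omega
  have hR : ∀ x y, x ≠ y → ∃ i, R x i ∉ Set.range (R y) := by
    rintro (x | x) (y | y) hxy
    · exact exists_tangentIndex_notMem_range fun h => hxy (h ▸ rfl)
    · obtain ⟨i₀, hx⟩ := exists_tangentIndex_eq_inl x (by omega)
      obtain ⟨j₀, hy⟩ := exists_tangentIndex_eq_inl y (by omega)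
      obtain ⟨i, j, hi, hj, hij⟩ := hpick i₀
      -- Away from `i₀` the indices of `x` lie in the first block, which the indices of `y` can meet
      -- only at position `j₀`. Two such positions would share one index, against injectivity.
      have key : ∀ i, i ≠ i₀ → R (Sum.inl x) i ∈ Set.range (R (Sum.inr y)) →
          R (Sum.inl x) i = R (Sum.inr y) j₀ := by
        rintro i hi ⟨l, hl⟩
        by_cases hlj : l = j₀
        · rw [← hl, hlj]
        · simp [R, hx i hi, hy l hlj, swapBlocks_symm_inl] at hl
      by_contra! hcon
      exact hij (tangentIndex_injective x
        ((key i hi (hcon i)).trans (key j hj (hcon j)).symm))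
    · obtain ⟨i₀, hx⟩ := exists_tangentIndex_eq_inl x (by omega)
      obtain ⟨j₀, hy⟩ := exists_tangentIndex_eq_inl y (by omega)
      obtain ⟨i, j, hi, hj, hij⟩ := hpick i₀
      have key : ∀ i, i ≠ i₀ → R (Sum.inr x) i ∈ Set.range (R (Sum.inl y)) →
          R (Sum.inr x) i = R (Sum.inl y) j₀ := by
        rintro i hi ⟨l, hl⟩
        by_cases hlj : l = j₀
        · rw [← hl, hlj]
        · simp [R, hx i hi, hy l hlj, swapBlocks_symm_inl] at hl
      by_contra! hcon
      exact hij (tangentIndex_injective x ((swapBlocks k μ).symm.injective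
        ((key i hi (hcon i)).trans (key j hj (hcon j)).symm)))
    · obtain ⟨i, hi⟩ := exists_tangentIndex_notMem_range (x := x) (y := y) fun h => hxy (h ▸ rfl)
      refine ⟨i, ?_⟩
      rintro ⟨l, hl⟩
      exact hi ⟨l, (swapBlocks k μ).symm.injective hl⟩
  have hinj : ∀ x, Function.Injective (R x) := by
    rintro (x | x)
    · exact tangentIndex_injective x
    · exact (swapBlocks k μ).symm.injective.comp (tangentIndex_injective x)
  convert linearIndependent_wedge_basis b R hinj hR using 1
  funext x
  rcases x with x | x
  · rfl
  · exact congrArg (exteriorPower.ιMulti K k) (funext fun i => b.reindex_apply _ _)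

end Wedges

/-! ### Parametrization of chords -/

section Joins

variable {K : Type*} [Field K] {E : Type*} [AddCommGroup E] [Module K E] {σ τ : Type*}

/-- The map parametrizing the chords between the images of two maps. -/
def joinMap (h : (σ → K) → E) (h' : (τ → K) → E) (t : σ ⊕ Option τ → K) : E :=
  h (fun i => t (Sum.inl i)) + (1 + t (Sum.inr none)) • h' fun i => t (Sum.inr (some i))

theorem IsPolyMap.joinMap {h : (σ → K) → E} {h' : (τ → K) → E} (hh : IsPolyMap h)
    (hh' : IsPolyMap h') : IsPolyMap (joinMap h h') :=
  (hh.comp fun i => isPolyFun_coord (Sum.inl i)).add <|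
    IsPolyMap.smul ((isPolyFun_const 1).add (isPolyFun_coord (Sum.inr none))) <|
      hh'.comp fun i => isPolyFun_coord (Sum.inr (some i))

theorem joinMap_zero (h : (σ → K) → E) (h' : (τ → K) → E) : joinMap h h' 0 = h 0 + h' 0 := by
  simp only [joinMap, Pi.zero_apply, add_zero, one_smul]
  rfl

theorem joinMap_single [DecidableEq σ] [DecidableEq τ] {h : (σ → K) → E} {h' : (τ → K) → E}
    {D : σ → E} {D' : τ → E} (hD : ∀ j (ε : K), h (Pi.single j ε) = h 0 + ε • D j)
    (hD' : ∀ j (ε : K), h' (Pi.single j ε) = h' 0 + ε • D' j) (j : σ ⊕ Option τ) (ε : K) :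
    joinMap h h' (Pi.single j ε) =
      joinMap h h' 0 + ε • (Sum.elim D (fun o => o.elim (h' 0) D') j : E) := by
  rw [joinMap_zero]
  rcases j with j | _ | j
  · have h1 : (fun i => (Pi.single (Sum.inl j) ε : σ ⊕ Option τ → K) (Sum.inl i)) =
        Pi.single j ε := by
      funext i
      simp [Pi.single_apply]
    have h2 : (fun i => (Pi.single (Sum.inl j) ε : σ ⊕ Option τ → K) (Sum.inr (some i))) = 0 := by
      funext i
      simp
    rw [joinMap, h1, h2, hD]
    simp only [Pi.single_apply, reduceCtorEq, if_false, add_zero, one_smul, Sum.elim_inl]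
    abel
  · have h1 : (fun i => (Pi.single (Sum.inr none) ε : σ ⊕ Option τ → K) (Sum.inl i)) = 0 := by
      funext i
      simp
    have h2 : (fun i => (Pi.single (Sum.inr none) ε : σ ⊕ Option τ → K) (Sum.inr (some i))) =
        0 := by
      funext i
      simp
    rw [joinMap, h1, h2, Pi.single_eq_same, add_smul, one_smul, add_assoc]
    rfl
  · have h1 : (fun i => (Pi.single (Sum.inr (some j)) ε : σ ⊕ Option τ → K) (Sum.inl i)) = 0 := by
      funext i
      simp
    have h2 : (fun i => (Pi.single (Sum.inr (some j)) ε : σ ⊕ Option τ → K) (Sum.inr (some i))) =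
        Pi.single j ε := by
      funext i
      simp [Pi.single_apply]
    rw [joinMap, h1, h2, hD']
    simp [add_assoc]

/-- The shift by 1 in `joinMap` puts the origin at `h 0 + h' 0`, off both endpoints. Replacing `h 0`
by this sum is a unipotent change of the family, so independence persists. -/
theorem linearIndependent_joinMap [Fintype σ] [Fintype τ] {h : (σ → K) → E} {h' : (τ → K) → E}
    {D : σ → E} {D' : τ → E}
    (hli : LinearIndependent K (Sum.elim (fun o : Option σ => o.elim (h 0) D)
      (fun o : Option τ => o.elim (h' 0) D'))) :
    LinearIndependent K (fun o : Option (σ ⊕ Option τ) =>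
      o.elim (joinMap h h' 0) (Sum.elim D fun o => o.elim (h' 0) D')) := by
  rw [Fintype.linearIndependent_iff] at hli ⊢
  intro c hc
  have h1 := hli (Sum.elim (fun o => o.elim (c none) fun i => c (some (Sum.inl i)))
    (fun o => o.elim (c none + c (some (Sum.inr none))) fun i => c (some (Sum.inr (some i))))) (by
      rw [← hc]
      simp only [Fintype.sum_option, Fintype.sum_sum_type, Sum.elim_inl, Sum.elim_inr,
        Option.elim_none, Option.elim_some, joinMap_zero, smul_add, add_smul]
      abel)
  have h0 : c none = 0 := h1 (Sum.inl none)
  rintro (_ | i | _ | i)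
  · exact h0
  · exact h1 (Sum.inl (some i))
  · have h2 : c none + c (some (Sum.inr none)) = 0 := h1 (Sum.inr none)
    rwa [h0, zero_add] at h2
  · exact h1 (Sum.inr (some i))

/-- A polynomial that vanishes at all but finitely many points of a curve vanishes on it. -/
theorem evalAt_eq_zero_of_generic [Infinite K] {h : (Unit → K) → E} (hh : IsPolyMap h)
    {p : MvPolynomial (Dual K E) K} {χ : Polynomial K} (hχ : χ ≠ 0)
    (hp : ∀ t : K, χ.eval t ≠ 0 → evalAt K (h fun _ => t) p = 0) : evalAt K (h 0) p = 0 := by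
  let P : Polynomial K := MvPolynomial.aeval (fun _ => Polynomial.X) (hh.pullback p)
  have hP : ∀ t, P.eval t = evalAt K (h fun _ => t) p := by
    intro t
    rw [← hh.eval_pullback]
    simp only [P]
    generalize hh.pullback p = r
    induction r using MvPolynomial.induction_on with
    | C a => simp
    | add p q hp hq => simp [hp, hq]
    | mul_X p i hp => simp [hp]
  have h0 : P * χ = 0 := by
    refine Polynomial.funext fun t => ?_
    rw [Polynomial.eval_mul, Polynomial.eval_zero]
    by_cases ht : χ.eval t = 0
    · rw [ht, mul_zero]
    · rw [hP, hp t ht, zero_mul]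
  have h1 := hP 0
  rw [(mul_eq_zero.mp h0).resolve_right hχ, Polynomial.eval_zero] at h1
  exact h1.symm

theorem evalAt_smul_eq_zero {p : MvPolynomial (Dual K E) K} {d : ℕ} (hp : p.IsHomogeneous d)
    {x : E} (hx : evalAt K x p = 0) (c : K) : evalAt K (c • x) p = 0 := by
  rw [evalAt_smul K hp, hx, mul_zero]

end Joins

/-! ### Dimensions of the Grassmann variety and its chordal variety -/

section Dimensions

variable {K : Type*} [Field K] {V : Type*} [AddCommGroup V] [Module K V] [Module.Finite K V]
  {k : ℕ} {κ : Type*} [Fintype κ]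

theorem exists_plucker_eq (b : Basis (Fin k ⊕ κ) K V) (a : Fin k × κ → K) :
    ∃ h0 : chart b a ≠ 0, Projectivization.mk K (chart b a) h0 ∈ grassmannVariety K V k := by
  have hli := linearIndependent_chartVec b a
  refine ⟨wedge_ne_zero hli,
    ⟨⟨Submodule.span K (Set.range (chartVec b a)), ?_⟩, ?_⟩⟩
  · rw [finrank_span_eq_card hli, Fintype.card_fin]
  · exact plucker_eq_mk _ _ hli fun i => Submodule.subset_span ⟨i, rfl⟩

theorem isPolyMap_perturbation (v u : Fin k → V) : IsPolyMap fun t : Unit → K =>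
    exteriorPower.ιMulti K k fun i => v i + t () • u i :=
  IsPolyMap.multilinear (exteriorPower.ιMulti K k).toMultilinearMap fun _ =>
    (isPolyMap_const _).add (IsPolyMap.smul (isPolyFun_coord ()) (isPolyMap_const _))

/-- This is the density of the big cell: the perturbed wedge is a multiple of a chart value for all
but finitely many `t`, and the vanishing extends to `t = 0`. -/
theorem evalAt_wedge_eq_zero [Infinite K] (b : Basis (Fin k ⊕ κ) K V)
    {p : MvPolynomial (Dual K (⋀[K]^k V)) K} {d : ℕ} (hp : p.IsHomogeneous d)
    (h0 : ∀ a, evalAt K (chart b a) p = 0) (v : Fin k → V) :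
    evalAt K (exteriorPower.ιMulti K k v) p = 0 := by
  obtain ⟨χ, hχ, h⟩ := exists_perturbation_eq_chart b v
  have := evalAt_eq_zero_of_generic (isPolyMap_perturbation v (b ∘ Sum.inl)) (p := p) hχ
    fun t ht => by
      obtain ⟨c, -, a, hc⟩ := h t ht
      dsimp only [Function.comp_apply]
      rw [hc]
      exact evalAt_smul_eq_zero hp (h0 a) c
  simpa using this

theorem evalAt_chord_eq_zero [Infinite K] (b b' : Basis (Fin k ⊕ κ) K V)
    {p : MvPolynomial (Dual K (⋀[K]^k V)) K} {d : ℕ} (hp : p.IsHomogeneous d)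
    (h0 : ∀ t, evalAt K (joinMap (chart b) (chart b') t) p = 0) (v v' : Fin k → V) (c c' : K) :
    evalAt K (c • exteriorPower.ιMulti K k v + c' • exteriorPower.ιMulti K k v') p = 0 := by
  obtain ⟨χ, hχ, h⟩ := exists_perturbation_eq_chart b v
  obtain ⟨χ', hχ', h'⟩ := exists_perturbation_eq_chart b' v'
  have hpoly : IsPolyMap fun t : Unit → K =>
      (c + t ()) • (exteriorPower.ιMulti K k fun i => v i + t () • (b ∘ Sum.inl) i) +
        c' • exteriorPower.ιMulti K k fun i => v' i + t () • (b' ∘ Sum.inl) i :=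
    (IsPolyMap.smul ((isPolyFun_const c).add (isPolyFun_coord ())) (isPolyMap_perturbation v _)).add
      (IsPolyMap.smul (isPolyFun_const c') (isPolyMap_perturbation v' _))
  -- `joinMap` has first coefficient 1, so the first coefficient of the chord must be invertible.
  -- Perturbing `c` to `c + t` and excluding its root covers `c = 0` as well.
  have := evalAt_eq_zero_of_generic hpoly (p := p) (χ := χ * χ' * (Polynomial.X + Polynomial.C c))
    (mul_ne_zero (mul_ne_zero hχ hχ') (Polynomial.X_add_C_ne_zero c)) fun t ht => by
      simp only [Polynomial.eval_mul, mul_ne_zero_iff, Polynomial.eval_add, Polynomial.eval_X,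
        Polynomial.eval_C] at ht
      obtain ⟨⟨ht1, ht2⟩, ht3⟩ := ht
      obtain ⟨s, hs, a, hsa⟩ := h t ht1
      obtain ⟨s', -, a', hsa'⟩ := h' t ht2
      dsimp only [Function.comp_apply]
      rw [hsa, hsa']
      have hne : (c + t) * s ≠ 0 := mul_ne_zero (by rwa [add_comm]) hs
      have hj : (c + t) • s • chart b a + c' • s' • chart b' a' = ((c + t) * s) •
          joinMap (chart b) (chart b')
            (Sum.elim a fun o => o.elim (c' * s' / ((c + t) * s) - 1) a') := by
        simp only [joinMap, Sum.elim_inl, Sum.elim_inr, Option.elim_none, Option.elim_some,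
          add_sub_cancel, smul_add, smul_smul]
        rw [mul_div_cancel₀ _ hne]
      rw [hj]
      exact evalAt_smul_eq_zero hp (h0 _) _
  simpa using this

/-- The dimension of the Grassmann variety. -/
theorem zariskiDim_grassmannVariety [CharZero K] (b : Basis (Fin k ⊕ κ) K V) :
    zariskiDim K (grassmannVariety K V k) = (Fintype.card (Fin k × κ) : WithBot ℕ∞) := by
  classical
  refine le_antisymm (zariskiDim_le_card ?_ (isPolyMap_chart b) ?_)
    (card_le_zariskiDim (isPolyMap_chart b)
      (fun x => exteriorPower.ιMulti K k (b ∘ tangentIndex (some x))) (chart_single b) ?_ ?_)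
  · exact ⟨_, (exists_plucker_eq b 0).2⟩
  · rintro p d hp h0 _ ⟨W, rfl⟩
    rw [plucker, evalAt_rep_mk_eq_zero_iff hp]
    exact evalAt_wedge_eq_zero b hp h0 _
  · rw [option_elim_chart_zero]
    exact linearIndependent_wedge_basis b tangentIndex tangentIndex_injective
      fun _ _ => exists_tangentIndex_notMem_range
  · rintro _ ⟨t, ht, rfl⟩
    exact (exists_plucker_eq b t).2

theorem mk_joinMap_mem_secantVariety (b b' : Basis (Fin k ⊕ κ) K V) :
    projImage (joinMap (chart b) (chart b')) ⊆ secantVariety K (grassmannVariety K V k) 2 := by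
  rintro _ ⟨t, ht, rfl⟩
  refine @subset_closure _ (zariskiTopology K _) _ _ ?_
  obtain ⟨h0, hG⟩ := exists_plucker_eq b fun i => t (Sum.inl i)
  obtain ⟨h0', hG'⟩ := exists_plucker_eq b' fun i => t (Sum.inr (some i))
  let P : Fin 2 → grassmannVariety K V k := ![⟨_, hG⟩, ⟨_, hG'⟩]
  refine Set.mem_iUnion.mpr ⟨P, ?_⟩
  let S := Projectivization.Subspace.span (Set.range fun i => (P i : ℙ K (⋀[K]^k V)))
  have h1 : chart b (fun i => t (Sum.inl i)) ∈ Projectivization.Subspace.submodule S :=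
    (Projectivization.Subspace.mem_submodule_iff S h0).mpr
      (Projectivization.Subspace.subset_span _ ⟨0, rfl⟩)
  have h2 : chart b' (fun i => t (Sum.inr (some i))) ∈ Projectivization.Subspace.submodule S :=
    (Projectivization.Subspace.mem_submodule_iff S h0').mpr
      (Projectivization.Subspace.subset_span _ ⟨1, rfl⟩)
  exact (Projectivization.Subspace.mem_submodule_iff S ht).mp
    (Submodule.add_mem _ h1 (Submodule.smul_mem _ _ h2))

theorem evalAt_rep_eq_zero_of_mem_secantVariety [Infinite K] (b b' : Basis (Fin k ⊕ κ) K V)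
    {p : MvPolynomial (Dual K (⋀[K]^k V)) K} {d : ℕ} (hp : p.IsHomogeneous d)
    (h0 : ∀ t, evalAt K (joinMap (chart b) (chart b') t) p = 0) {x : ℙ K (⋀[K]^k V)}
    (hx : x ∈ secantVariety K (grassmannVariety K V k) 2) : evalAt K x.rep p = 0 := by
  refine @closure_minimal _ (zariskiTopology K _) _ {x : ℙ K (⋀[K]^k V) | evalAt K x.rep p = 0} ?_
    (isClosed_evalAt_eq_zero hp) x hx
  intro y hy
  obtain ⟨P, hy⟩ := Set.mem_iUnion.mp hy
  obtain ⟨W, hW⟩ := (P 0).2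
  obtain ⟨W', hW'⟩ := (P 1).2
  let v : Fin k → V := fun i => (finBasisOfFinrankEq K W.1 W.2 i : V)
  let v' : Fin k → V := fun i => (finBasisOfFinrankEq K W'.1 W'.2 i : V)
  -- `U` is not required to be a plane, so coincident points need no separate case.
  let U : Submodule K (⋀[K]^k V) :=
    Submodule.span K {exteriorPower.ιMulti K k v, exteriorPower.ιMulti K k v'}
  have hle : Projectivization.Subspace.span (Set.range fun i => (P i : ℙ K (⋀[K]^k V))) ≤
      Projectivization.Subspace.submodule.symm U := by
    rw [Projectivization.Subspace.span_le_subspace_iff]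
    have hmem : ∀ (u : ⋀[K]^k V) (hu : u ≠ 0), u ∈ U →
        Projectivization.mk K u hu ∈ Projectivization.Subspace.submodule.symm U := by
      intro u hu huU
      rwa [← Projectivization.Subspace.mem_submodule_iff, OrderIso.apply_symm_apply]
    rintro _ ⟨i, rfl⟩
    fin_cases i
    · change (P 0 : ℙ K (⋀[K]^k V)) ∈ _
      rw [← hW]
      exact hmem _ _ (Submodule.subset_span (by simp [v]))
    · change (P 1 : ℙ K (⋀[K]^k V)) ∈ _
      rw [← hW']
      exact hmem _ _ (Submodule.subset_span (by simp [v']))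
  have hyU : y.rep ∈ U := by
    have h1 := hle hy
    rw [← Projectivization.mk_rep y] at h1
    have h2 := (Projectivization.Subspace.mem_submodule_iff _ y.rep_nonzero).mpr h1
    rwa [OrderIso.apply_symm_apply] at h2
  obtain ⟨c, c', hcc⟩ := Submodule.mem_span_pair.mp hyU
  change evalAt K y.rep p = 0
  rw [← hcc]
  exact evalAt_chord_eq_zero b b' hp h0 v v' c c'

/-- The expected dimension of the chordal variety is attained, and does not exceed that of the
ambient space. -/
theorem zariskiDim_secantVariety_grassmannVariety [CharZero K] (hk : 3 ≤ k) {μ : Type*}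
    [Fintype μ] (b : Basis (Fin k ⊕ (Fin k ⊕ μ)) K V) :
    zariskiDim K (secantVariety K (grassmannVariety K V k) 2) =
        ((2 * Fintype.card (Fin k × (Fin k ⊕ μ)) + 1 : ℕ) : WithBot ℕ∞) ∧
      2 * Fintype.card (Fin k × (Fin k ⊕ μ)) + 2 ≤ finrank K (⋀[K]^k V) := by
  classical
  let b' := b.reindex (swapBlocks k μ)
  have hli := linearIndependent_tangents hk b
  have hj := (isPolyMap_chart b).joinMap (isPolyMap_chart b')
  rw [← option_elim_chart_zero, ← option_elim_chart_zero] at hli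
  have hli' := linearIndependent_joinMap hli
  have hcard : Fintype.card ((Fin k × (Fin k ⊕ μ)) ⊕ Option (Fin k × (Fin k ⊕ μ))) =
      2 * Fintype.card (Fin k × (Fin k ⊕ μ)) + 1 := by
    rw [Fintype.card_sum, Fintype.card_option]
    ring
  have hsub := mk_joinMap_mem_secantVariety b b'
  rw [← hcard]
  refine ⟨le_antisymm (zariskiDim_le_card ?_ hj ?_)
    (card_le_zariskiDim hj _ (joinMap_single (chart_single b) (chart_single b')) hli' hsub), ?_⟩
  · exact ⟨_, hsub ⟨0, hli'.ne_zero none, rfl⟩⟩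
  · exact fun p d hp h0 x hx => evalAt_rep_eq_zero_of_mem_secantVariety b b' hp h0 hx
  · have := hli'.fintype_card_le_finrank
    rw [Fintype.card_option, hcard] at this
    exact this

end Dimensions

end SecantGrassmann

theorem corollary2p2 {K : Type*} [Field K] [IsAlgClosed K] [CharZero K]
    {V : Type*} [AddCommGroup V] [Module K V] [Module.Finite K V]
    (n k : ℕ) (hV : Module.finrank K V = n + 1) (hk : 3 ≤ k) (hkn : k ≤ (n + 1) / 2) :
    SecantGrassmann.HasExpectedSecantDim K (SecantGrassmann.grassmannVariety K V k) 2 ∧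
      SecantGrassmann.zariskiDim K
          (SecantGrassmann.secantVariety K (SecantGrassmann.grassmannVariety K V k) 2) =
        ((min ((n + 1).choose k - 1) (2 * (k * (n + 1 - k)) + 1) : ℕ) : WithBot ℕ∞) := by
  -- The bound on `k` leaves room for two disjoint blocks of size `k`, with `n + 1 - 2 * k` basis
  -- vectors to spare.
  have hm : finrank K V = Fintype.card (Fin k ⊕ (Fin k ⊕ Fin (n + 1 - 2 * k))) := by
    simp only [Fintype.card_sum, Fintype.card_fin]
    omega
  let b : Basis (Fin k ⊕ (Fin k ⊕ Fin (n + 1 - 2 * k))) K V :=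
    (finBasis K V).reindex (Fintype.equivOfCardEq (by rw [Fintype.card_fin, hm]))
  have hd : Fintype.card (Fin k × (Fin k ⊕ Fin (n + 1 - 2 * k))) = k * (n + 1 - k) := by
    simp only [Fintype.card_prod, Fintype.card_sum, Fintype.card_fin]
    congr 1
    omega
  have hG := SecantGrassmann.zariskiDim_grassmannVariety b
  obtain ⟨hS, hN⟩ := SecantGrassmann.zariskiDim_secantVariety_grassmannVariety hk b
  rw [hd] at hG hS hN
  have hE : finrank K (⋀[K]^k V) = (n + 1).choose k := by rw [exteriorPower.finrank_eq, hV]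
  refine ⟨⟨_, hG, ?_⟩, ?_⟩
  · rw [hS, min_eq_right (by omega)]
  · rw [hS, min_eq_right (by omega)]
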